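/- Let $k$ be an algebraically closed field of characteristic different from $2$ and $3$. Let $\alpha,\beta,\gamma\in k\setminus\{0,1,-1\}$ satisfy $\alpha+\beta+\gamma+\alpha\beta\gamma=0$, and fix $a,b,c,i\in k$ with $a^2=\alpha$, $b^2=\beta$, $c^2=\gamma$, $i^2=-1$; write $(\alpha_1,\alpha_2,\alpha_3)=(\alpha,\beta,\gamma)$. Let $S$ be the 4-dimensional Sklyanin algebra: the $k$-algebra generated by $x_0,x_1,x_2,x_3$ (in degree one) with relations $$x_0x_r-x_rx_0=\alpha_r(x_sx_t+x_tx_s),\qquad x_0x_r+x_rx_0=x_sx_t-x_tx_s,$$ where $(r,s,t)$ runs over the cyclic permutations of $(1,2,3)$. Put $$q_0=\begin{pmatrix}1&0\\0&1\end{pmatrix},\quad q_1=\begin{pmatrix}i&0\\0&-i\end{pmatrix},\quad q_2=\begin{pmatrix}0&i\\i&0\end{pmatrix},\quad q_3=\begin{pmatrix}0&-1\\1&0\end{pmatrix}.$$ Let $\Gamma=(\mathbb Z/2)\times(\mathbb Z/2)=\{1=\gamma_0,\gamma_1,\gamma_2,\gamma_3\}$ act on $S$ by algebra automorphisms with $\gamma_j(x_n)=x_n$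 if $j=0$, $n=0$ or $j=n$, and $\gamma_j(x_n)=-x_n$ otherwise; on $M_2(k)$ by $\gamma_j(m)=q_jmq_j^{-1}$; and diagonally on $S'=S\otimes M_2(k)$, graded by $S'_n=S_n\otimes M_2(k)$. Let $A=(S')^\Gamma$, graded by $A_n=A\cap S'_n$, and let $y_n=x_n\otimes q_n\in A_1$ ($n=0,\dots,3$). For $j\in\{0,1,2,3\}$ let $V(\tau+\xi_j)=k^2$ be the $S$-module on which $(x_0,x_1,x_2,x_3)$ act by the matrices $$\begin{aligned} j=0:&\quad(1,\;q_1,\;q_2,\;q_3), & j=1:&\quad(bc\,q_1,\;-i,\;-ib\,q_3,\;-c\,q_2),\\ j=2:&\quad(ac\,q_2,\;-a\,q_3,\;-i,\;-ic\,q_1), & j=3:&\quad(ab\,q_3,\;-ia\,q_2,\;-b\,q_1,\;-i).\end{aligned}$$ Let $\widetilde V(\tau+\xi_j)=V(\tau+\xi_j)\otimes k[t]$ be the graded $S$-module in which $v\otimes t^m$ has degree $m$ and $s(v\otimes t^m)=(sv)\otimes t^{m+n}$ for $s\in S_n$. Then $\widetilde V(\tau+\xi_j)\otimes k^2$ is a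 graded left $S'$-module. A $\Gamma$-equivariant structure on it is a degree-preserving $k$-linear left action of $\Gamma$ such that $\gamma(zf)=\gamma(z)\gamma(f)$ for $\gamma\in\Gamma$, $z\in S'$ and $f$ in the module. An isomorphism of such structures is a degree-preserving $\Gamma$-equivariant isomorphism of $S'$-modules. A point module for $A$ is a graded left $A$-module with Hilbert series $(1-t)^{-1}$ that is generated in degree $0$. For $p\in\mathbb P(A_1^*)$ let $p^\perp\subseteq A_1$ be the space of linear forms vanishing at $p$ and let $M_p=A/Ap^\perp$. In the coordinates $(y_0,y_1,y_2,y_3)$ let $$\begin{aligned} \mathfrak P_0&=\{(1,1,1,1),\,(1,1,-1,-1),\,(1,-1,1,-1),\,(1,-1,-1,1)\},\\ \mathfrak P_1&=\{(bc,-i,-ib,-c),\,(bc,-i,ib,c),\,(bc,i,-ib,c),\,(bc,i,ib,-c)\},\\ \mathfrak P_2&=\{(ac,-a,-i,-ic),\,(ac,-a,i,ic),\,(ac,a,-i,ic),\,(ac,a,i,-ic)\},\\ \mathfrak P_3&=\{(ab,-ia,-b,-i),\,(ab,-ia,b,i),\,(ab,ia,-b,i),\,(ab,ia,b,-i)\}.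 \end{aligned}$$ Then, for every $j\in\{0,1,2,3\}$: 1. Up to isomorphism there are exactly four $\Gamma$-equivariant structures on the graded $S'$-module $\widetilde V(\tau+\xi_j)\otimes k^2$. 2. $\mathfrak P_j$ consists of four distinct points, and the modules $M_p$, $p\in\mathfrak P_j$, are pairwise non-isomorphic point modules for $A$. 3. For every $\Gamma$-equivariant structure on $\widetilde V(\tau+\xi_j)\otimes k^2$ there is a point $p\in\mathfrak P_j$ such that $(\widetilde V(\tau+\xi_j)\otimes k^2)^\Gamma\cong M_p$ as graded $A$-modules. 4. For every $p\in\mathfrak P_j$ there is a $\Gamma$-equivariant structure on $\widetilde V(\tau+\xi_j)\otimes k^2$, unique up to isomorphism, such that $(\widetilde V(\tau+\xi_j)\otimes k^2)^\Gamma\cong M_p$ as graded $A$-modules. -/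

import Mathlib

open scoped TensorProduct Polynomial LinearAlgebra.Projectivization

noncomputable section

namespace Sklyanin

/-- The parameters `α₁ = α`, `α₂ = β`, `α₃ = γ` in `k ∖ {0, 1, -1}` with `α + β + γ + αβγ = 0`,
together with fixed square roots `a, b, c` of them and a fixed square root `i` of `-1`. -/
structure Parameters (k : Type*) [Field k] where
  (α β γ a b c i : k)
  sum_eq : α + β + γ + α * β * γ = 0
  α_ne : α ≠ 0 ∧ α ≠ 1 ∧ α ≠ -1
  β_ne : β ≠ 0 ∧ β ≠ 1 ∧ β ≠ -1
  γ_ne : γ ≠ 0 ∧ γ ≠ 1 ∧ γ ≠ -1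
  a_sq : a ^ 2 = α
  b_sq : b ^ 2 = β
  c_sq : c ^ 2 = γ
  i_sq : i ^ 2 = -1

variable {k : Type*} [Field k] (D : Parameters k)

/-! ### The Sklyanin algebra -/

/-- The free generators. -/
abbrev freeX (k : Type*) [Field k] (n : Fin 4) : FreeAlgebra k (Fin 4) := FreeAlgebra.ι k n

/-- The six defining relations
`x₀xᵢ - xᵢx₀ = αᵢ(xⱼxₗ + xₗxⱼ)` and `x₀xᵢ + xᵢx₀ = xⱼxₗ - xₗxⱼ`,
with `(i, j, l)` running over the cyclic permutations of `(1, 2, 3)`. -/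
inductive Rel : FreeAlgebra k (Fin 4) → FreeAlgebra k (Fin 4) → Prop
  | comm₁ : Rel (freeX k 0 * freeX k 1 - freeX k 1 * freeX k 0) (D.α • (freeX k 2 * freeX k 3 + freeX k 3 * freeX k 2))
  | comm₂ : Rel (freeX k 0 * freeX k 2 - freeX k 2 * freeX k 0) (D.β • (freeX k 3 * freeX k 1 + freeX k 1 * freeX k 3))
  | comm₃ : Rel (freeX k 0 * freeX k 3 - freeX k 3 * freeX k 0) (D.γ • (freeX k 1 * freeX k 2 + freeX k 2 * freeX k 1))
  | anti₁ : Rel (freeX k 0 * freeX k 1 + freeX k 1 * freeX k 0) (freeX k 2 * freeX k 3 - freeX k 3 * freeX k 2)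
  | anti₂ : Rel (freeX k 0 * freeX k 2 + freeX k 2 * freeX k 0) (freeX k 3 * freeX k 1 - freeX k 1 * freeX k 3)
  | anti₃ : Rel (freeX k 0 * freeX k 3 + freeX k 3 * freeX k 0) (freeX k 1 * freeX k 2 - freeX k 2 * freeX k 1)

/-- The 4-dimensional Sklyanin algebra `S`. -/
def S : Type _ := RingQuot (Rel D)

instance : Semiring (S D) := inferInstanceAs (Semiring (RingQuot (Rel D)))

instance : Algebra k (S D) := inferInstanceAs (Algebra k (RingQuot (Rel D)))

instance : Ring (S D) := Algebra.semiringToRing k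

/-- The quotient map from the free algebra. -/
def mkS : FreeAlgebra k (Fin 4) →ₐ[k] S D := RingQuot.mkAlgHom k (Rel D)

/-- The generators `x₀, x₁, x₂, x₃` of `S`. -/
def x (n : Fin 4) : S D := mkS D (freeX k n)

/-- The homogeneous component `Sₙ`: the span of the products of `n` generators. -/
def degS (n : ℕ) : Submodule k (S D) := (Submodule.span k (Set.range (x D))) ^ n

/-- The algebra homomorphism out of `S` given by the images of the generators. -/
def liftS {B : Type*} [Ring B] [Algebra k B] (f : Fin 4 → B)
    (h : ∀ ⦃u v⦄, Rel D u v → FreeAlgebra.lift k f u = FreeAlgebra.lift k f v) : S D →ₐ[k] B :=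
  RingQuot.liftAlgHom k ⟨FreeAlgebra.lift k f, h⟩

@[simp] theorem liftS_x {B : Type*} [Ring B] [Algebra k B] (f : Fin 4 → B)
    (h : ∀ ⦃u v⦄, Rel D u v → FreeAlgebra.lift k f u = FreeAlgebra.lift k f v) (n : Fin 4) :
    liftS D f h (x D n) = f n := by
  change RingQuot.liftAlgHom k _ (RingQuot.mkAlgHom k (Rel D) (freeX k n)) = f n
  simp [freeX]

variable {D} in
theorem S_hom_ext {B : Type*} [Ring B] [Algebra k B] {f g : S D →ₐ[k] B}
    (h : ∀ n, f (x D n) = g (x D n)) : f = g := by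
  apply RingQuot.ringQuot_ext'
  apply FreeAlgebra.hom_ext
  funext n
  exact h n

/-- The relations of `S`, in `S`. -/
theorem S_rel {u v : FreeAlgebra k (Fin 4)} (h : Rel D u v) :
    FreeAlgebra.lift k (x D) u = FreeAlgebra.lift k (x D) v := by
  have e : FreeAlgebra.lift k (x D) = mkS D := by
    apply FreeAlgebra.hom_ext
    funext n
    simp [x, freeX]
  rw [e]
  exact RingQuot.mkAlgHom_rel k h

/-! ### The action of `Γ` -/

/-- The group `Γ = (ℤ/2) × (ℤ/2)`. -/
abbrev Γ : Type := Multiplicative (ZMod 2 × ZMod 2)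

/-- The labelling `γ₀ = 1`, `γ₁ = (1, 0)`, `γ₂ = (0, 1)`, `γ₃ = γ₁γ₂` of the elements of `Γ`:
`index γⱼ = j`. -/
def index (g : Γ) : Fin 4 :=
  if g.toAdd = (0, 0) then 0 else if g.toAdd = (1, 0) then 1 else
    if g.toAdd = (0, 1) then 2 else 3

/-- `γⱼ` multiplies `xₙ` by `1` if `j = 0` or `n = 0` or `j = n`, and by `-1` otherwise. -/
def sgn (g : Γ) (n : Fin 4) : ℤ := if index g = 0 ∨ n = 0 ∨ index g = n then 1 else -1

theorem sgn_mul (g h : Γ) (n : Fin 4) : sgn (g * h) n = sgn g n * sgn h n := by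
  revert g h n; decide

theorem sgn_one (n : Fin 4) : sgn 1 n = 1 := by
  revert n; decide

theorem sgn_prod : ∀ g : Γ, sgn g 0 = 1 ∧ sgn g 2 * sgn g 3 = sgn g 1 ∧
    sgn g 3 * sgn g 1 = sgn g 2 ∧ sgn g 1 * sgn g 2 = sgn g 3 := by
  decide

theorem gammaS_rel (g : Γ) ⦃u v : FreeAlgebra k (Fin 4)⦄ (h : Rel D u v) :
    FreeAlgebra.lift k (fun n => sgn g n • x D n) u =
      FreeAlgebra.lift k (fun n => sgn g n • x D n) v := by
  obtain ⟨h0, h1, h2, h3⟩ := sgn_prod g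
  have h1' : sgn g 3 * sgn g 2 = sgn g 1 := by rw [mul_comm]; exact h1
  have h2' : sgn g 1 * sgn g 3 = sgn g 2 := by rw [mul_comm]; exact h2
  have h3' : sgn g 2 * sgn g 1 = sgn g 3 := by rw [mul_comm]; exact h3
  have r := S_rel D h
  cases h <;> simp only [freeX, map_sub, map_add, map_mul, map_smul, FreeAlgebra.lift_ι_apply,
    smul_mul_smul_comm, h0, one_mul, mul_one, h1, h2, h3, h1', h2', h3'] at r ⊢ <;>
    simp only [← smul_add, ← smul_sub, r] <;> rw [smul_comm]

/-- The action of `Γ` on `S` by algebra automorphisms: `γⱼ(xₙ) = ± xₙ`. -/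
def gammaS : Γ →* (S D →ₐ[k] S D) where
  toFun g := liftS D (fun n => sgn g n • x D n) (gammaS_rel D g)
  map_one' := S_hom_ext fun n => by simp [sgn_one]
  map_mul' g h := S_hom_ext fun n => by
    simp only [liftS_x, AlgHom.mul_apply, map_zsmul, sgn_mul, mul_smul]
    rw [smul_comm]

@[simp] theorem gammaS_x (g : Γ) (n : Fin 4) : gammaS D g (x D n) = sgn g n • x D n := by
  simp [gammaS]

/-- The matrix algebra `M₂(k)`. -/
abbrev M₂ (k : Type*) [Field k] : Type _ := Matrix (Fin 2) (Fin 2) k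

/-- The quaternion matrices `q₀ = 1, q₁, q₂, q₃`. -/
def q : Fin 4 → M₂ k :=
  ![!![1, 0; 0, 1], !![D.i, 0; 0, -D.i], !![0, D.i; D.i, 0], !![0, -1; 1, 0]]

theorem i_mul_i : D.i * D.i = -1 := by rw [← sq, D.i_sq]

/-- `q₀⁻¹ = q₀` and `qⱼ⁻¹ = -qⱼ` for `j = 1, 2, 3`. -/
def qInv : Fin 4 → M₂ k := ![q D 0, -q D 1, -q D 2, -q D 3]

theorem q_mul_qInv (j : Fin 4) : q D j * qInv D j = 1 := by
  fin_cases j <;> simp [q, qInv, Matrix.one_fin_two, i_mul_i]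

theorem qInv_mul_q (j : Fin 4) : qInv D j * q D j = 1 := by
  fin_cases j <;> simp [q, qInv, Matrix.one_fin_two, i_mul_i]

theorem q_inv (j : Fin 4) : (q D j)⁻¹ = qInv D j :=
  Matrix.inv_eq_right_inv (q_mul_qInv D j)

/-- The index of `γᵢγⱼ`. -/
def mulIndex : Fin 4 → Fin 4 → Fin 4 :=
  ![![0, 1, 2, 3], ![1, 0, 3, 2], ![2, 3, 0, 1], ![3, 2, 1, 0]]

theorem q_mul (m n : Fin 4) : ∃ s : k, s * s = 1 ∧ q D (mulIndex m n) = s • (q D m * q D n) ∧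
    qInv D (mulIndex m n) = s • (qInv D n * qInv D m) := by
  have hi := i_mul_i D
  fin_cases m <;> fin_cases n <;>
    first
    | refine ⟨1, by norm_num, ?_, ?_⟩ <;>
        (simp [q, qInv, mulIndex, hi]; done)
    | refine ⟨-1, by norm_num, ?_, ?_⟩ <;>
        simp [q, qInv, mulIndex, hi]

theorem q_conj (g h : Γ) (m : M₂ k) :
    q D (index (g * h)) * m * qInv D (index (g * h)) =
      q D (index g) * (q D (index h) * m * qInv D (index h)) * qInv D (index g) := by
  have key : (∃ s : k, s * s = 1 ∧ q D (index (g * h)) = s • (q D (index g) * q D (index h)) ∧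
      qInv D (index (g * h)) = s • (qInv D (index h) * qInv D (index g))) := by
    have hi : index (g * h) = mulIndex (index g) (index h) := by revert g h; decide
    rw [hi]
    exact q_mul D _ _
  obtain ⟨s, hs, e1, e2⟩ := key
  rw [e1, e2]
  simp only [Matrix.smul_mul, Matrix.mul_smul, smul_smul, hs, one_smul, Matrix.mul_assoc]

/-- The action of `Γ` on `M₂(k)`: `γⱼ(m) = qⱼ m qⱼ⁻¹`. -/
def gammaM : Γ →* (M₂ k →ₐ[k] M₂ k) where
  toFun g :=
    { toFun := fun m => q D (index g) * m * (q D (index g))⁻¹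
      map_one' := by rw [mul_one, q_inv, q_mul_qInv]
      map_mul' := fun m n => by
        rw [q_inv]
        simp only [mul_assoc]
        rw [← mul_assoc (qInv D (index g)) (q D (index g)), qInv_mul_q, one_mul]
      map_zero' := by simp
      map_add' := fun m n => by rw [mul_add, add_mul]
      commutes' := fun r => by
        rw [q_inv, ← Algebra.commutes, mul_assoc, q_mul_qInv, mul_one] }
  map_one' := by
    ext1 m
    have h : index 1 = 0 := by decide
    simp [h, q, ← Matrix.one_fin_two]
  map_mul' g h := by
    ext1 m
    simpa [q_inv] using q_conj D g h m

/-- The algebra `S' = S ⊗ M₂(k)`. -/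
abbrev S' : Type _ := S D ⊗[k] M₂ k

instance : Ring (S' D) :=
  { (inferInstance : Semiring (S' D)), (Algebra.TensorProduct.instRing : Ring (S' D)) with }

/-- The homogeneous component `S'ₙ = Sₙ ⊗ M₂(k)`. -/
def degS' (n : ℕ) : Submodule k (S' D) :=
  Submodule.span k {z | ∃ s ∈ degS D n, ∃ m : M₂ k, z = s ⊗ₜ[k] m}

/-- The diagonal action of `Γ` on `S'`. -/
def gamma : Γ →* (S' D →ₐ[k] S' D) where
  toFun g := Algebra.TensorProduct.map (gammaS D g) (gammaM D g)
  map_one' := by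
    simp only [map_one]
    exact Algebra.TensorProduct.map_id
  map_mul' g h := by
    simp only [map_mul]
    exact Algebra.TensorProduct.map_comp _ _ _ _

/-! ### The algebra `A` of invariants -/

/-- `A = (S ⊗ M₂(k))^Γ`. -/
def A : Subalgebra k (S' D) where
  carrier := {z | ∀ g, gamma D g z = z}
  mul_mem' := fun hx hy g => by rw [map_mul, hx g, hy g]
  add_mem' := fun hx hy g => by rw [map_add, hx g, hy g]
  algebraMap_mem' := fun r g => AlgHom.commutes _ r

/-- The homogeneous component `Aₙ = A ∩ S'ₙ`. -/
def degA (n : ℕ) : Submodule k (A D) := (degS' D n).comap (A D).val.toLinearMap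

theorem gammaM_q (g : Γ) (n : Fin 4) : gammaM D g (q D n) = sgn g n • q D n := by
  change q D (index g) * q D n * (q D (index g))⁻¹ = sgn g n • q D n
  rw [q_inv, sgn]
  generalize index g = j
  have hi := i_mul_i D
  fin_cases j <;> fin_cases n <;> simp [q, qInv, hi]

/-- The elements `yₙ = xₙ ⊗ qₙ` of `A₁`. -/
def y (n : Fin 4) : A D :=
  ⟨x D n ⊗ₜ[k] q D n, fun g => by
    have h : sgn g n * sgn g n = 1 := by
      have : ∀ (g : Γ) (n : Fin 4), sgn g n * sgn g n = 1 := by decide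
      exact this g n
    change Algebra.TensorProduct.map (gammaS D g) (gammaM D g) _ = _
    rw [Algebra.TensorProduct.map_tmul, gammaS_x, gammaM_q, ← Int.cast_smul_eq_zsmul k,
      ← Int.cast_smul_eq_zsmul k, TensorProduct.smul_tmul, smul_smul, ← Int.cast_mul, h,
      Int.cast_one, one_smul]⟩

/-! ### The modules `V(τ + ξⱼ)`, their homogenizations, and `Ṽ(τ + ξⱼ) ⊗ k²` -/

/-- The matrix by which `xₙ` acts on `V(τ + ξⱼ)`, in row `j` and column `n`. -/
def rhoX : Fin 4 → Fin 4 → M₂ k :=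
  ![![1, q D 1, q D 2, q D 3],
    ![(D.b * D.c) • q D 1, -(D.i • 1), -((D.i * D.b) • q D 3), -(D.c • q D 2)],
    ![(D.a * D.c) • q D 2, -(D.a • q D 3), -(D.i • 1), -((D.i * D.c) • q D 1)],
    ![(D.a * D.b) • q D 3, -((D.i * D.a) • q D 2), -(D.b • q D 1), -(D.i • 1)]]

theorem q_mul_table :
    q D 1 * q D 2 = q D 3 ∧ q D 2 * q D 3 = q D 1 ∧ q D 3 * q D 1 = q D 2 ∧
    q D 2 * q D 1 = -q D 3 ∧ q D 3 * q D 2 = -q D 1 ∧ q D 1 * q D 3 = -q D 2 := by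
  have hi := i_mul_i D
  refine ⟨?_, ?_, ?_, ?_, ?_, ?_⟩ <;> simp [q, hi]

theorem rho_rel (j : Fin 4) ⦃u v : FreeAlgebra k (Fin 4)⦄ (h : Rel D u v) :
    FreeAlgebra.lift k (rhoX D j) u = FreeAlgebra.lift k (rhoX D j) v := by
  have hi := D.i_sq
  have ha := D.a_sq
  have hb := D.b_sq
  have hc := D.c_sq
  obtain ⟨h12, h23, h31, h21, h32, h13⟩ := q_mul_table D
  cases h <;> simp only [freeX, map_sub, map_add, map_mul, map_smul,
    FreeAlgebra.lift_ι_apply] <;> fin_cases j <;>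
    simp only [rhoX, Fin.isValue, Fin.mk_one, Fin.zero_eta, Fin.reduceFinMk, Matrix.cons_val,
      smul_mul_smul_comm, neg_mul, mul_neg, h12, h23, h31,
      h21, h32, h13, one_mul, mul_one] <;>
    match_scalars <;> grind

/-- The structure map `ρⱼ : S → M₂(k)` of the 2-dimensional simple `S`-module `V(τ + ξⱼ) = k²`. -/
def rho (j : Fin 4) : S D →ₐ[k] M₂ k := liftS D (rhoX D j) (rho_rel D j)

/-- The space `k²` of column vectors. -/
abbrev K2 (k : Type*) [Field k] : Type _ := Fin 2 → k

/-- The operator on `V(τ + ξⱼ) ⊗ k[t]` given by `v ⊗ tᵐ ↦ (xₙ v) ⊗ tᵐ⁺¹`. -/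
def homogX (j n : Fin 4) : Module.End k (K2 k ⊗[k] k[X]) :=
  TensorProduct.map (Matrix.toLin' (rhoX D j n)) (LinearMap.mulLeft k Polynomial.X)

theorem homogX_mul (j m n : Fin 4) : homogX D j m * homogX D j n =
    TensorProduct.map (Matrix.toLin' (rhoX D j m * rhoX D j n))
      (LinearMap.mulLeft k (Polynomial.X * Polynomial.X)) := by
  rw [Matrix.toLin'_mul, LinearMap.mulLeft_mul, TensorProduct.map_comp]
  rfl

/-- The operator `v ⊗ tᵐ ↦ (M v) ⊗ tᵐ⁺²`, as a linear function of the matrix `M`. -/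
def homogSq : M₂ k →ₗ[k] Module.End k (K2 k ⊗[k] k[X]) where
  toFun M := TensorProduct.map (Matrix.toLin' M)
    (LinearMap.mulLeft k (Polynomial.X * Polynomial.X : k[X]))
  map_add' M N := by rw [map_add, TensorProduct.map_add_left]
  map_smul' r M := by rw [map_smul, TensorProduct.map_smul_left]; rfl

theorem homogX_rel (j : Fin 4) ⦃u v : FreeAlgebra k (Fin 4)⦄ (h : Rel D u v) :
    FreeAlgebra.lift k (homogX D j) u = FreeAlgebra.lift k (homogX D j) v := by
  have r := rho_rel D j h
  have e : ∀ M : M₂ k, TensorProduct.map (Matrix.toLin' M)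
      (LinearMap.mulLeft k (Polynomial.X * Polynomial.X : k[X])) = homogSq M := fun _ => rfl
  cases h <;> simp only [freeX, map_sub, map_add, map_mul, map_smul,
    FreeAlgebra.lift_ι_apply, homogX_mul, e] at r ⊢ <;>
    simp only [← map_smul, ← map_add, ← map_sub, r]

/-- The structure map `S → End(V(τ + ξⱼ) ⊗ k[t])` of the graded module `Ṽ(τ + ξⱼ)`, given on
generators; `homog_apply` below describes the action of all of `Sₙ`. -/
def homog (j : Fin 4) : S D →ₐ[k] Module.End k (K2 k ⊗[k] k[X]) :=
  liftS D (homogX D j) (homogX_rel D j)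

/-- An element `s` of degree `n` acts on `Ṽ(τ + ξⱼ)` by `s (v ⊗ tᵐ) = (s v) ⊗ tᵐ⁺ⁿ`. -/
theorem homog_apply (j : Fin 4) (n m : ℕ) (s : S D) (hs : s ∈ degS D n) (v : K2 k) :
    homog D j s (v ⊗ₜ[k] (Polynomial.X ^ m : k[X])) =
      (rho D j s).mulVec v ⊗ₜ[k] (Polynomial.X ^ (m + n) : k[X]) := by
  induction hs using Submodule.pow_induction_on_left' generalizing v with
  | algebraMap r =>
    simp [Algebra.algebraMap_eq_smul_one, Matrix.smul_mulVec, TensorProduct.smul_tmul']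
  | add s t i hs ht ihs iht =>
    rw [map_add, LinearMap.add_apply, ihs, iht, map_add, Matrix.add_mulVec, TensorProduct.add_tmul]
  | mem_mul s hs i t ht ih =>
    rw [map_mul, Module.End.mul_apply, ih, map_mul, ← Matrix.mulVec_mulVec]
    generalize (rho D j t).mulVec v = w
    induction hs using Submodule.span_induction with
    | mem s hs =>
      obtain ⟨l, rfl⟩ := hs
      simp only [homog, rho, liftS_x, homogX, TensorProduct.map_tmul, Matrix.toLin'_apply,
        LinearMap.mulLeft_apply]
      congr 1
      rw [Nat.succ_eq_add_one]
      ring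
    | zero => simp
    | add s t hs ht ihs iht =>
      rw [map_add, LinearMap.add_apply, ihs, iht, map_add, Matrix.add_mulVec,
        TensorProduct.add_tmul]
    | smul r s hs ihs =>
      rw [map_smul, LinearMap.smul_apply, ihs, map_smul, Matrix.smul_mulVec,
        TensorProduct.smul_tmul']

/-- The `k`-space underlying the `S'`-module `Ṽ(τ + ξⱼ) ⊗ k²`. -/
def FK2 (_D : Parameters k) (_j : Fin 4) : Type _ := (K2 k ⊗[k] k[X]) ⊗[k] K2 k

instance (j : Fin 4) : AddCommGroup (FK2 D j) :=
  inferInstanceAs (AddCommGroup ((K2 k ⊗[k] k[X]) ⊗[k] K2 k))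

instance (j : Fin 4) : Module k (FK2 D j) :=
  inferInstanceAs (Module k ((K2 k ⊗[k] k[X]) ⊗[k] K2 k))

/-- The structure map of the `S'`-module `Ṽ(τ + ξⱼ) ⊗ k²`: the factor `S` acts on `Ṽ(τ + ξⱼ)` and
the factor `M₂(k)` acts on `k²` as usual. -/
def action (j : Fin 4) : S' D →ₐ[k] Module.End k (FK2 D j) :=
  (Module.endTensorEndAlgHom (R := k) (A := k) (M := K2 k ⊗[k] k[X]) (N := K2 k)).comp
    (Algebra.TensorProduct.map (homog D j) (Matrix.toLinAlgEquiv' (R := k) (n := Fin 2)).toAlgHom)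

instance (j : Fin 4) : Module (S' D) (FK2 D j) :=
  Module.compHom (FK2 D j) (action D j).toRingHom

theorem smul_def (j : Fin 4) (z : S' D) (f : FK2 D j) : z • f = action D j z f := rfl

/-- `(s ⊗ m)(f ⊗ w) = (s f) ⊗ (m w)`. -/
theorem smul_tmul (j : Fin 4) (s : S D) (m : M₂ k) (f : K2 k ⊗[k] k[X]) (w : K2 k) :
    (s ⊗ₜ[k] m : S' D) • (show FK2 D j from f ⊗ₜ[k] w) =
      (show FK2 D j from homog D j s f ⊗ₜ[k] m.mulVec w) := rfl

instance (j : Fin 4) : IsScalarTower k (S' D) (FK2 D j) where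
  smul_assoc r z f := by
    rw [smul_def, smul_def, map_smul]; rfl

/-- The homogeneous component of degree `n` of `Ṽ(τ + ξⱼ) ⊗ k²`, spanned by the elements
`(v ⊗ tⁿ) ⊗ w`. -/
def degFK2 (j : Fin 4) (n : ℕ) : Submodule k (FK2 D j) :=
  Submodule.span k {f | ∃ v w : K2 k,
    f = (show FK2 D j from (v ⊗ₜ[k] (Polynomial.X ^ n : k[X])) ⊗ₜ[k] w)}

/-! ### Equivariant structures -/

/-- A `Γ`-equivariant structure on the graded left `S'`-module `Ṽ(τ + ξⱼ) ⊗ k²`: a degree-preserving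
left action of `Γ` such that `γ(z f) = γ(z) γ(f)` for `z ∈ S'`. -/
structure EquivariantStructure (j : Fin 4) where
  act : Γ →* Module.End k (FK2 D j)
  act_mem : ∀ (g : Γ) (n : ℕ), ∀ f ∈ degFK2 D j n, act g f ∈ degFK2 D j n
  act_smul : ∀ (g : Γ) (z : S' D) (f : FK2 D j), act g (z • f) = gamma D g z • act g f

variable {D} {j : Fin 4}

/-- Isomorphism of `Γ`-equivariant graded `S'`-modules. -/
def EquivariantStructure.Iso (σ σ' : EquivariantStructure D j) : Prop :=
  ∃ e : FK2 D j ≃ₗ[S' D] FK2 D j,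
    (∀ n f, f ∈ degFK2 D j n ↔ e f ∈ degFK2 D j n) ∧ ∀ g f, e (σ.act g f) = σ'.act g (e f)

/-- Isomorphism of equivariant structures is an equivalence relation. -/
def EquivariantStructure.setoid (D : Parameters k) (j : Fin 4) :
    Setoid (EquivariantStructure D j) where
  r := EquivariantStructure.Iso
  iseqv :=
    { refl := fun _ => ⟨LinearEquiv.refl _ _, fun _ _ => Iff.rfl, fun _ _ => rfl⟩
      symm := fun ⟨e, h1, h2⟩ => ⟨e.symm, fun n f => by
          rw [h1 n (e.symm f), LinearEquiv.apply_symm_apply], fun g f => by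
          rw [LinearEquiv.symm_apply_eq, h2, LinearEquiv.apply_symm_apply]⟩
      trans := fun ⟨e, h1, h2⟩ ⟨e', h1', h2'⟩ => ⟨e.trans e', fun n f => by
          rw [h1, h1']; rfl, fun g f => by
          simp [h2, h2']⟩ }

/-- The `A`-module `(Ṽ(τ + ξⱼ) ⊗ k²)^Γ` of invariants of an equivariant structure. -/
def EquivariantStructure.invariants (σ : EquivariantStructure D j) :
    Submodule (A D) (FK2 D j) where
  carrier := {f | ∀ g, σ.act g f = f}
  add_mem' := fun hx hy g => by rw [map_add, hx g, hy g]
  zero_mem' := fun g => map_zero _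
  smul_mem' := fun z f hf g => by
    change σ.act g ((z : S' D) • f) = (z : S' D) • f
    rw [σ.act_smul, z.2 g, hf g]

/-- The homogeneous components of the module of invariants. -/
def EquivariantStructure.degInvariants (σ : EquivariantStructure D j) (n : ℕ) :
    Submodule k σ.invariants :=
  (degFK2 D j n).comap (σ.invariants.subtype.restrictScalars k)

/-! ### Point modules for `A` -/

variable (D)

/-- `N`, with homogeneous components `degN n`, is a point module for `A`: a graded `A`-module
generated in degree zero with Hilbert series `(1 - t)⁻¹`. -/
structure IsPointModule {N : Type*} [AddCommMonoid N] [Module k N] [Module (A D) N]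
    (degN : ℕ → Submodule k N) : Prop where
  isInternal : DirectSum.IsInternal degN
  smul_mem : ∀ m n, ∀ z ∈ degA D m, ∀ f ∈ degN n, z • f ∈ degN (m + n)
  finrank_eq : ∀ n, Module.finrank k (degN n) = 1
  span_eq : Submodule.span (A D) (degN 0 : Set N) = ⊤

/-- Isomorphism of graded `A`-modules. -/
def GrIso {N N' : Type*} [AddCommMonoid N] [Module k N] [Module (A D) N]
    [AddCommMonoid N'] [Module k N'] [Module (A D) N']
    (degN : ℕ → Submodule k N) (degN' : ℕ → Submodule k N') : Prop :=
  ∃ e : N ≃ₗ[A D] N', ∀ n f, f ∈ degN n ↔ e f ∈ degN' n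

/-- The left ideal `A p^⊥`, where `p^⊥ ⊆ A₁` is the space of linear forms `∑ cₙ yₙ` that vanish at
the point `p ∈ ℙ(A₁^*)`, given by its coordinates with respect to `y₀, y₁, y₂, y₃`. -/
def perpIdeal (p : ℙ k (Fin 4 → k)) : Ideal (A D) :=
  Ideal.span {z | ∃ c : Fin 4 → k, (∀ v ∈ p.submodule, ∑ n, c n * v n = 0) ∧
    z = ∑ n, c n • y D n}

/-- The graded `A`-module `M_p = A / A p^⊥`. -/
abbrev pointModule (p : ℙ k (Fin 4 → k)) : Type _ := A D ⧸ perpIdeal D p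

/-- The homogeneous components of `M_p`, the images of the `Aₙ`. -/
def degPoint (p : ℙ k (Fin 4 → k)) (n : ℕ) : Submodule k (pointModule D p) :=
  (degA D n).map ((perpIdeal D p).mkQ.restrictScalars k)

/-- Coordinates of the four points of `𝔓ⱼ`, `j = 0, 1, 2, 3`. -/
def pointCoord : Fin 4 → Fin 4 → (Fin 4 → k) :=
  ![![![1, 1, 1, 1],
      ![1, 1, -1, -1],
      ![1, -1, 1, -1],
      ![1, -1, -1, 1]],
    ![![D.b * D.c, -D.i, -D.i * D.b, -D.c],
      ![D.b * D.c, -D.i, D.i * D.b, D.c],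
      ![D.b * D.c, D.i, -D.i * D.b, D.c],
      ![D.b * D.c, D.i, D.i * D.b, -D.c]],
    ![![D.a * D.c, -D.a, -D.i, -D.i * D.c],
      ![D.a * D.c, -D.a, D.i, D.i * D.c],
      ![D.a * D.c, D.a, -D.i, D.i * D.c],
      ![D.a * D.c, D.a, D.i, -D.i * D.c]],
    ![![D.a * D.b, -D.i * D.a, -D.b, -D.i],
      ![D.a * D.b, -D.i * D.a, D.b, D.i],
      ![D.a * D.b, D.i * D.a, -D.b, D.i],
      ![D.a * D.b, D.i * D.a, D.b, -D.i]]]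

/-- The set `𝔓ⱼ` of points of `ℙ(A₁^*)`. -/
def ordinaryPoints (j : Fin 4) : Set (ℙ k (Fin 4 → k)) :=
  {p | ∃ (r : Fin 4) (h : pointCoord D j r ≠ 0), p = Projectivization.mk k (pointCoord D j r) h}

end Sklyanin

end

/-! ### The commutation signs of the quaternion matrices. -/

noncomputable section

namespace Sklyanin

/-! The argument rests on one observation: on V(τ+ξⱼ) the generator xₗ acts by a nonzero multiple
κⱼₗ of qⱼqₗ (`rhoX_eq`), and the q's commute up to signs that form a perfect pairing of Γ with
itself. Writing (v ⊗ tⁿ) ⊗ w as the matrix v wᵀ identifies every homogeneous component of Ṽ(τ+ξⱼ) ⊗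
k² with M₂(k), and S' acts by left multiplication with ρⱼ and right multiplication with transposes
(`tmul_smul_emb`).

Equivariant structures: a graded S'-endomorphism is left multiplication by matrices commuting with
all qₗ, hence a scalar (`exists_smul_of_graded_endomorphism`). So two equivariant structures differ
by a character of Γ. An explicit structure exists, with M ↦ ± q M qᵀ for q = q_g, and its twists by
the four characters are all of them (`eq_std`). Since isomorphisms are scalars, different characters
give non-isomorphic structures (`eq_of_std_iso`).

Invariants: in the coordinate N given by M = qⱼⁿ qᵣ N q₃, the r-th structure is conjugation of N, so
the invariants in degree n are the line through qⱼⁿ qᵣ q₃. The form yₗ carries this line to the next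
one with factor κⱼₗ up to sign (`y_smul_invVec`), and in degree 0 these factors are the coordinates
of a point of 𝔓ⱼ.

Point modules: averaging over Γ shows that A is generated by the yₗ (`degA_eq`). If e' spans a
component of M_p and the yₗ map it to multiples of e by the coordinates of a point of 𝔓ⱼ, the
quadratic relations of A force the yₗe to be proportional to another point of 𝔓ⱼ
(`PointEquations.exists_eq_smul_coord`). Hence M_p is spanned by one vector per degree, while its
map to the invariants sends these vectors to a basis; so that map is an isomorphism
(`toInvariants_bijective`). Finally p is recovered from M_p as the way A₁ maps degree 0 to degree 1
(`eq_of_grIso`). -/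

/-- The sign with which `q l` and `q r` commute. -/
def sg (l r : Fin 4) : ℤ := if l = 0 ∨ r = 0 ∨ l = r then 1 else -1

theorem sgn_eq_sg (g : Γ) (n : Fin 4) : sgn g n = sg (index g) n := rfl

theorem sg_mul_self (l r : Fin 4) : sg l r * sg l r = 1 := by revert l r; decide

theorem sg_comm (l r : Fin 4) : sg l r = sg r l := by revert l r; decide

theorem sg_zero (l : Fin 4) : sg l 0 = 1 := by revert l; decide

theorem sg_mulIndex (l m n : Fin 4) : sg l (mulIndex m n) = sg l m * sg l n := by
  revert l m n; decide

/-- The columns of the sign table are the four distinct characters of Γ. -/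
theorem sg_injective {r r' : Fin 4} (h : ∀ l, sg l r = sg l r') : r = r' := by
  revert r r'; decide

theorem mulIndex_mulIndex (m n : Fin 4) : mulIndex m (mulIndex m n) = n := by
  revert m n; decide

theorem index_surjective : Function.Surjective index := by
  intro n; revert n; decide

theorem index_mul (g h : Γ) : index (g * h) = mulIndex (index g) (index h) := by
  revert g h; decide

theorem gamma_mul_self (g : Γ) : g * g = 1 := by revert g; decide

section

variable {k : Type*} [Field k] (D : Parameters k)

theorem sg_cast_mul_self (l r : Fin 4) : (sg l r : k) * sg l r = 1 := by
  rw [← Int.cast_mul, sg_mul_self, Int.cast_one]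

theorem sg_cast_ne_zero (l r : Fin 4) : (sg l r : k) ≠ 0 :=
  left_ne_zero_of_mul_eq_one (sg_cast_mul_self l r)

theorem sg_cast_injective (h2 : (2 : k) ≠ 0) {r r' : Fin 4}
    (h : ∀ l, (sg l r : k) = sg l r') : r = r' := by
  have h1 : (1 : k) ≠ -1 := fun h => h2 (by linear_combination h)
  refine sg_injective fun l => ?_
  have := h l
  unfold sg at this ⊢
  split_ifs at this ⊢ <;> simp_all [eq_comm]

theorem i_ne_zero : D.i ≠ 0 := by
  intro h; have := D.i_sq; simp [h] at this

theorem a_ne_zero : D.a ≠ 0 := by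
  intro h; have := D.a_sq; exact D.α_ne.1 (by simp [← this, h])

theorem b_ne_zero : D.b ≠ 0 := by
  intro h; have := D.b_sq; exact D.β_ne.1 (by simp [← this, h])

theorem c_ne_zero : D.c ≠ 0 := by
  intro h; have := D.c_sq; exact D.γ_ne.1 (by simp [← this, h])

/-! ### The quaternion matrices -/

theorem q_zero : q D 0 = 1 := by simp [q, Matrix.one_fin_two]

theorem q_commute (l r : Fin 4) : q D l * q D r = (sg l r : k) • (q D r * q D l) := by
  have hi := i_mul_i D
  fin_cases l <;> fin_cases r <;> simp [q, sg, hi]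

theorem mul_qInv_of_commute {l : Fin 4} {N : M₂ k} {s : k} (h : q D l * N = s • (N * q D l)) :
    N * qInv D l = s • (qInv D l * N) := by
  have h := congrArg (fun M => qInv D l * M * qInv D l) h
  simp only [Matrix.mul_smul, Matrix.smul_mul] at h
  rw [← mul_assoc, qInv_mul_q, one_mul, mul_assoc, mul_assoc, q_mul_qInv, mul_one] at h
  exact h

/-- Each qₗ has determinant 1 and q₃ is the matrix of the symplectic form on k², so conjugating a
transpose by q₃ gives the adjugate, here the inverse. This converts the right action through
transposes into conjugation. -/
theorem q_transpose (l : Fin 4) : q D 3 * (q D l).transpose = qInv D l * q D 3 := by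
  have hi := i_mul_i D
  fin_cases l <;> ext a b <;> fin_cases a <;> fin_cases b <;> simp [q, qInv, Matrix.mul_apply]

theorem isUnit_q (l : Fin 4) : IsUnit (q D l) :=
  ⟨⟨q D l, qInv D l, q_mul_qInv D l, qInv_mul_q D l⟩, rfl⟩

theorem exists_eq_sum_q (h2 : (2 : k) ≠ 0) (m : M₂ k) : ∃ c : Fin 4 → k, m = ∑ l, c l • q D l := by
  have hi := i_ne_zero D
  refine ⟨![(m 0 0 + m 1 1) / 2, (m 0 0 - m 1 1) / (2 * D.i), (m 0 1 + m 1 0) / (2 * D.i),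
    (m 1 0 - m 0 1) / 2], ?_⟩
  ext a b
  fin_cases a <;> fin_cases b <;> simp [q, Fin.sum_univ_four] <;> field_simp <;> ring

/-- The distinct eigenvalues ±i of q₁ force P to be diagonal, and q₃ interchanges the two diagonal
entries. -/
theorem eq_smul_one_of_commute (h2 : (2 : k) ≠ 0) (P : M₂ k) (h1 : P * q D 1 = q D 1 * P)
    (h3 : P * q D 3 = q D 3 * P) : P = P 0 0 • 1 := by
  have hi := i_ne_zero D
  have e1 := congrFun (congrFun h1 0) 1
  have e2 := congrFun (congrFun h1 1) 0
  have e3 := congrFun (congrFun h3 1) 0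
  simp [q, Matrix.mul_apply] at e1 e2 e3
  have f1 : P 0 1 = 0 := by
    have : 2 * D.i * P 0 1 = 0 := by linear_combination -e1
    simpa [h2, hi] using this
  have f2 : P 1 0 = 0 := by
    have : 2 * D.i * P 1 0 = 0 := by linear_combination e2
    simpa [h2, hi] using this
  ext a b
  fin_cases a <;> fin_cases b <;> simp [f1, f2, e3]

/-! ### The points of 𝔓ⱼ as sign changes of κⱼ. -/

/-- The scalars with `ρⱼ(xₗ) qₗ⁻¹ = κⱼₗ qⱼ`. -/
def kappa : Fin 4 → Fin 4 → k :=
  ![![1, 1, 1, 1], ![D.b * D.c, D.i, -(D.i * D.b), D.c],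
    ![D.a * D.c, D.a, D.i, -(D.i * D.c)], ![D.a * D.b, -(D.i * D.a), D.b, D.i]]

theorem kappa_ne_zero (j l : Fin 4) : kappa D j l ≠ 0 := by
  have hi := i_ne_zero D
  have ha := a_ne_zero D
  have hb := b_ne_zero D
  have hc := c_ne_zero D
  fin_cases j <;> fin_cases l <;> simp [kappa, *]

theorem rhoX_mul_qInv (j l : Fin 4) : rhoX D j l * qInv D l = kappa D j l • q D j := by
  obtain ⟨h12, h23, h31, h21, h32, h13⟩ := q_mul_table D
  have hq := q_mul_qInv D
  fin_cases j <;> fin_cases l <;>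
    simp [rhoX, qInv, kappa, q_zero, h12, h23, h31, h21, h32, h13] <;>
    first
      | exact q_zero D
      | simpa [qInv, q_zero] using hq 1
      | simpa [qInv, q_zero] using hq 2
      | simpa [qInv, q_zero] using hq 3

/-- This normal form treats the four modules uniformly: after it, only the signs and the
nonvanishing of κ matter, except where the relations of A are solved. -/
theorem rhoX_eq (j l : Fin 4) : rhoX D j l = kappa D j l • (q D j * q D l) := by
  rw [← Matrix.smul_mul, ← rhoX_mul_qInv, mul_assoc, qInv_mul_q, mul_one]

/-- The equivariant structures on `Ṽ(τ + ξⱼ) ⊗ k²` correspond to the points of `𝔓ⱼ` by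
multiplication with this index. -/
def shift : Fin 4 → Fin 4 := ![0, 2, 3, 1]

/-- The coordinates of the points of `𝔓ⱼ`, indexed by the equivariant structures. -/
def coord (j r l : Fin 4) : k := kappa D j l * sg l r

theorem coord_ne_zero (j r l : Fin 4) : coord D j r l ≠ 0 :=
  mul_ne_zero (kappa_ne_zero D j l) (sg_cast_ne_zero l r)

/-- The first point listed in 𝔓ⱼ is not κⱼ itself but κⱼ twisted by the character with index `shift
j`, so the two labellings differ by a translation in Γ. -/
theorem pointCoord_eq (j r : Fin 4) : pointCoord D j r = coord D j (mulIndex (shift j) r) := by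
  funext l
  fin_cases j <;> fin_cases r <;> fin_cases l <;>
    simp [pointCoord, coord, kappa, sg, mulIndex, shift]

/-- The point of `𝔓ⱼ` with coordinates `coord D j r`. -/
def point (j r : Fin 4) : ℙ k (Fin 4 → k) :=
  Projectivization.mk k (coord D j r) fun h => coord_ne_zero D j r 0 (congrFun h 0)

theorem ordinaryPoints_eq (j : Fin 4) : ordinaryPoints D j = Set.range (point D j) := by
  ext p
  constructor
  · rintro ⟨r, h, rfl⟩
    refine ⟨mulIndex (shift j) r, ?_⟩
    simp only [point, pointCoord_eq]
  · rintro ⟨r, rfl⟩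
    have e : pointCoord D j (mulIndex (shift j) r) = coord D j r := by
      rw [pointCoord_eq, mulIndex_mulIndex]
    refine ⟨mulIndex (shift j) r, fun h => coord_ne_zero D j r 0 (congrFun (e ▸ h) 0), ?_⟩
    simp only [point, e]

/-- After cancelling κⱼ, the coordinate l = 0 carries the sign 1 on both sides, so d = 1 and two
characters of Γ remain to be compared. -/
theorem eq_of_coord_eq_smul (h2 : (2 : k) ≠ 0) {j r r' : Fin 4} (d : k)
    (h : ∀ l, coord D j r l = d * coord D j r' l) : r = r' := by
  have h' : ∀ l, (sg l r : k) = d * sg l r' := fun l =>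
    mul_left_cancel₀ (kappa_ne_zero D j l) (by
      have := h l; simp only [coord] at this; linear_combination this)
  have h0 : d = 1 := by simpa [sg] using (h' 0).symm
  exact sg_cast_injective h2 fun l => by rw [h' l, h0, one_mul]

theorem point_injective (h2 : (2 : k) ≠ 0) (j : Fin 4) : Function.Injective (point D j) := by
  intro r r' h
  obtain ⟨d, hd⟩ := (Projectivization.mk_eq_mk_iff' k _ _ _ _).1 h
  exact eq_of_coord_eq_smul D h2 d fun l => (congrFun hd l).symm

theorem ncard_ordinaryPoints (h2 : (2 : k) ≠ 0) (j : Fin 4) : (ordinaryPoints D j).ncard = 4 := by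
  rw [ordinaryPoints_eq, ← Set.image_univ, Set.ncard_image_of_injective _ (point_injective D h2 j),
    Set.ncard_univ, Nat.card_eq_fintype_card, Fintype.card_fin]

end

section

variable {k : Type*} [Field k] (D : Parameters k) (j : Fin 4)

/-! ### Homogeneous elements of `Ṽ(τ + ξⱼ) ⊗ k²` -/

theorem matrix_hom_ext {N : Type*} [AddCommMonoid N] [Module k N] {φ ψ : M₂ k →ₗ[k] N}
    (h : ∀ v w, φ (Matrix.vecMulVec v w) = ψ (Matrix.vecMulVec v w)) : φ = ψ := by
  refine Matrix.ext_linearMap _ fun a b => LinearMap.ext_ring ?_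
  simp only [LinearMap.comp_apply, Matrix.singleLinearMap_apply]
  rw [Matrix.single_eq_single_vecMulVec_single]
  exact h _ _

/-- The element `∑ (v ⊗ tⁿ) ⊗ w` of degree `n` given by the matrix `∑ v wᵀ`. -/
def emb (n : ℕ) : M₂ k →ₗ[k] FK2 D j where
  toFun M := ∑ b, (show FK2 D j from
    ((M.col b) ⊗ₜ[k] (Polynomial.X ^ n : k[X])) ⊗ₜ[k] (Pi.single b 1 : K2 k))
  map_add' M N := by
    rw [← Finset.sum_add_distrib]
    refine Finset.sum_congr rfl fun b _ => ?_
    have : (M + N).col b = M.col b + N.col b := rfl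
    rw [this, TensorProduct.add_tmul, TensorProduct.add_tmul]; rfl
  map_smul' r M := by
    rw [Finset.smul_sum]
    refine Finset.sum_congr rfl fun b _ => ?_
    have : (r • M).col b = r • M.col b := rfl
    rw [this, ← TensorProduct.smul_tmul', ← TensorProduct.smul_tmul']; rfl

theorem emb_apply (n : ℕ) (M : M₂ k) : emb D j n M = ∑ b, (show FK2 D j from
    ((M.col b) ⊗ₜ[k] (Polynomial.X ^ n : k[X])) ⊗ₜ[k] (Pi.single b 1 : K2 k)) := rfl

theorem emb_vecMulVec (n : ℕ) (v w : K2 k) : emb D j n (Matrix.vecMulVec v w) =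
    (show FK2 D j from (v ⊗ₜ[k] (Polynomial.X ^ n : k[X])) ⊗ₜ[k] w) := by
  have hw : w = ∑ b, w b • (Pi.single b 1 : K2 k) := by
    ext b; simp [Pi.single_apply]
  conv_rhs => rw [hw]
  rw [emb_apply]
  refine Eq.trans (Finset.sum_congr rfl fun b _ => ?_) (TensorProduct.tmul_sum (R := k)
    (v ⊗ₜ[k] (Polynomial.X ^ n : k[X])) Finset.univ fun b => w b • (Pi.single b 1 : K2 k)).symm
  have : (Matrix.vecMulVec v w).col b = w b • v := by
    ext a; simp [Matrix.vecMulVec, mul_comm]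
  rw [this, ← TensorProduct.smul_tmul', TensorProduct.tmul_smul, ← TensorProduct.smul_tmul']

variable {D j} in
theorem FK2_hom_ext {N : Type*} [AddCommMonoid N] [Module k N] {φ ψ : FK2 D j →ₗ[k] N}
    (h : ∀ n M, φ (emb D j n M) = ψ (emb D j n M)) : φ = ψ := by
  refine TensorProduct.ext' fun f w => ?_
  induction f using TensorProduct.induction_on with
  | zero => rw [TensorProduct.zero_tmul]; exact (map_zero φ).trans (map_zero ψ).symm
  | add f g hf hg =>
    rw [TensorProduct.add_tmul]
    exact (map_add φ _ _).trans ((congrArg₂ _ hf hg).trans (map_add ψ _ _).symm)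
  | tmul v p =>
    induction p using Polynomial.induction_on' with
    | add p q hp hq =>
      rw [TensorProduct.tmul_add, TensorProduct.add_tmul]
      exact (map_add φ _ _).trans ((congrArg₂ _ hp hq).trans (map_add ψ _ _).symm)
    | monomial n r =>
      rw [← Polynomial.C_mul_X_pow_eq_monomial, ← Polynomial.smul_eq_C_mul,
        ← TensorProduct.smul_tmul]
      have := h n (Matrix.vecMulVec (r • v) w)
      rw [emb_vecMulVec] at this
      exact this

/-- The component of degree `n` of an element. -/
def coef (n : ℕ) : FK2 D j →ₗ[k] M₂ k :=
  (TensorProduct.lift (vecMulVecBilin k k)).comp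
    (TensorProduct.map ((TensorProduct.rid k (K2 k)).toLinearMap.comp
      (TensorProduct.map LinearMap.id (Polynomial.lcoeff k n))) LinearMap.id)

theorem coef_emb (m n : ℕ) (M : M₂ k) : coef D j m (emb D j n M) = if m = n then M else 0 := by
  have : (coef D j m).comp (emb D j n) = if m = n then LinearMap.id else 0 := by
    refine matrix_hom_ext fun v w => ?_
    rw [LinearMap.comp_apply, emb_vecMulVec]
    change Matrix.vecMulVec ((Polynomial.X ^ n : k[X]).coeff m • v) w = _
    rw [Polynomial.coeff_X_pow]
    split_ifs <;> simp
  have := LinearMap.congr_fun this M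
  rw [LinearMap.comp_apply] at this
  rw [this]
  split_ifs <;> rfl

theorem coef_emb_self (n : ℕ) (M : M₂ k) : coef D j n (emb D j n M) = M := by
  rw [coef_emb, if_pos rfl]

theorem emb_injective (n : ℕ) : Function.Injective (emb D j n) :=
  Function.LeftInverse.injective (coef_emb_self D j n)

theorem degFK2_eq (n : ℕ) : degFK2 D j n = LinearMap.range (emb D j n) := by
  apply le_antisymm
  · refine Submodule.span_le.2 ?_
    rintro _ ⟨v, w, rfl⟩
    exact ⟨_, emb_vecMulVec D j n v w⟩
  · rintro _ ⟨M, rfl⟩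
    rw [emb_apply]
    exact Submodule.sum_mem _ fun b _ => Submodule.subset_span ⟨_, _, rfl⟩

theorem emb_mem (n : ℕ) (M : M₂ k) : emb D j n M ∈ degFK2 D j n := by
  rw [degFK2_eq]; exact ⟨M, rfl⟩

variable {D j} in
theorem emb_coef {n : ℕ} {f : FK2 D j} (hf : f ∈ degFK2 D j n) : emb D j n (coef D j n f) = f := by
  rw [degFK2_eq] at hf
  obtain ⟨M, rfl⟩ := hf
  rw [coef_emb_self]

theorem iSup_degFK2 : ⨆ n, degFK2 D j n = ⊤ := by
  have : (⨆ n, degFK2 D j n).mkQ = 0 := FK2_hom_ext fun n M => by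
    rw [Submodule.mkQ_apply, LinearMap.zero_apply, Submodule.Quotient.mk_eq_zero]
    exact Submodule.mem_iSup_of_mem n (emb_mem D j n M)
  rw [← Submodule.ker_mkQ (⨆ n, degFK2 D j n), this, LinearMap.ker_zero]

variable {D j} in
theorem exists_eq_sum_emb (f : FK2 D j) : ∃ s : Finset ℕ, f = ∑ n ∈ s, emb D j n (coef D j n f) := by
  have hf : f ∈ ⨆ n, degFK2 D j n := by rw [iSup_degFK2]; trivial
  rw [Submodule.mem_iSup_iff_exists_finsupp] at hf
  obtain ⟨g, hg, rfl⟩ := hf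
  refine ⟨g.support, Finset.sum_congr rfl fun n hn => ?_⟩
  have hc : coef D j n (g.sum fun _ x => x) = coef D j n (g n) := by
    rw [Finsupp.sum, map_sum, Finset.sum_eq_single n]
    · intro m _ hm
      rw [← emb_coef (hg m), coef_emb, if_neg hm.symm]
    · intro h; exact absurd hn h
  rw [hc, emb_coef (hg n)]

/-- On rank one matrices, (sv)(mw)ᵀ = s (v wᵀ) mᵀ; these span M₂(k). -/
theorem tmul_smul_emb (s : S D) (d : ℕ) (hs : s ∈ degS D d) (m : M₂ k) (n : ℕ) (M : M₂ k) :
    (s ⊗ₜ[k] m : S' D) • emb D j n M = emb D j (n + d) (rho D j s * M * m.transpose) := by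
  have : (action D j (s ⊗ₜ[k] m)).comp (emb D j n) = (emb D j (n + d)).comp
      ((LinearMap.mulLeft k (rho D j s)).comp (LinearMap.mulRight k m.transpose)) := by
    refine matrix_hom_ext fun v w => ?_
    simp only [LinearMap.comp_apply, LinearMap.mulLeft_apply, LinearMap.mulRight_apply]
    rw [Matrix.vecMulVec_mul, Matrix.mul_vecMulVec, Matrix.vecMul_transpose, emb_vecMulVec,
      emb_vecMulVec, ← smul_def, smul_tmul, homog_apply D j d n s hs]
  have := LinearMap.congr_fun this M
  simp only [LinearMap.comp_apply, LinearMap.mulLeft_apply, LinearMap.mulRight_apply] at this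
  rw [smul_def, this, mul_assoc]

theorem x_mem_degS (l : Fin 4) : x D l ∈ degS D 1 := by
  rw [degS, pow_one]; exact Submodule.subset_span ⟨l, rfl⟩

theorem one_mem_degS : (1 : S D) ∈ degS D 0 := by
  rw [degS, pow_zero]; exact Submodule.one_le.1 le_rfl

theorem x_smul_emb (l : Fin 4) (m : M₂ k) (n : ℕ) (M : M₂ k) :
    (x D l ⊗ₜ[k] m : S' D) • emb D j n M = emb D j (n + 1) (rhoX D j l * M * m.transpose) := by
  rw [tmul_smul_emb D j _ 1 (x_mem_degS D l), rho, liftS_x]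

theorem one_smul_emb (m : M₂ k) (n : ℕ) (M : M₂ k) :
    ((1 : S D) ⊗ₜ[k] m : S' D) • emb D j n M = emb D j n (M * m.transpose) := by
  rw [tmul_smul_emb D j _ 0 (one_mem_degS D), map_one, one_mul, add_zero]

/-! ### Generators of `S` and `S'` -/

theorem adjoin_range_x : Algebra.adjoin k (Set.range (x D)) = ⊤ := by
  have h : Set.range (x D) = mkS D '' Set.range (FreeAlgebra.ι k) := by
    rw [← Set.range_comp]; rfl
  rw [h, ← AlgHom.map_adjoin, FreeAlgebra.adjoin_range_ι, Algebra.map_top, AlgHom.range_eq_top]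
  exact RingQuot.mkAlgHom_surjective k (Rel D)

/-- S ⊗ M₂(k) is generated as a ring by the elements xₗ ⊗ 1 and 1 ⊗ m, so compatibility of a
Γ-action with S' need only be tested on them. -/
theorem S'_induction {P : S' D → Prop} (hadd : ∀ z z', P z → P z' → P (z + z'))
    (hmul : ∀ z z', P z → P z' → P (z * z')) (hx : ∀ l, P (x D l ⊗ₜ 1))
    (hm : ∀ m, P (1 ⊗ₜ m)) (z : S' D) : P z := by
  induction z using TensorProduct.induction_on with
  | zero => simpa using hm 0
  | add z z' h h' => exact hadd _ _ h h'
  | tmul s m =>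
    have hs : s ∈ Algebra.adjoin k (Set.range (x D)) := by rw [adjoin_range_x]; trivial
    have : P (s ⊗ₜ 1) := by
      induction hs using Algebra.adjoin_induction with
      | mem s hs => obtain ⟨l, rfl⟩ := hs; exact hx l
      | algebraMap r =>
        rw [Algebra.algebraMap_eq_smul_one, TensorProduct.smul_tmul]; exact hm _
      | add s t _ _ hs ht => rw [TensorProduct.add_tmul]; exact hadd _ _ hs ht
      | mul s t _ _ hs ht =>
        have := hmul _ _ hs ht
        rwa [Algebra.TensorProduct.tmul_mul_tmul, one_mul] at this
    have := hmul _ _ this (hm m)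
    rwa [Algebra.TensorProduct.tmul_mul_tmul, one_mul, mul_one] at this

end

section

variable {k : Type*} [Field k] (D : Parameters k) (j : Fin 4)

/-! ### The standard equivariant structures -/

/-- The operator `p ↦ p(s t)` on polynomials. -/
def scaleVar (s : k) : k[X] →ₗ[k] k[X] :=
  (Polynomial.aeval (Polynomial.C s * Polynomial.X)).toLinearMap

theorem scaleVar_X_pow (s : k) (n : ℕ) :
    scaleVar s (Polynomial.X ^ n) = s ^ n • (Polynomial.X ^ n : k[X]) := by
  simp [scaleVar, mul_pow, Polynomial.smul_eq_C_mul]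

/-- The operator `(v ⊗ tⁿ) ⊗ w ↦ ± (q v ⊗ tⁿ) ⊗ q w`, where `q = q_g` and the sign is
`sg g r * (sg g j)ⁿ`. -/
def stdEnd (r : Fin 4) (g : Γ) : Module.End k (FK2 D j) :=
  (sg (index g) r : k) • (show Module.End k (FK2 D j) from
    (TensorProduct.map (TensorProduct.map (Matrix.toLin' (q D (index g)))
      (scaleVar (sg (index g) j : k))) (Matrix.toLin' (q D (index g))) :
      Module.End k ((K2 k ⊗[k] k[X]) ⊗[k] K2 k)))

theorem stdEnd_emb (r : Fin 4) (g : Γ) (n : ℕ) (M : M₂ k) :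
    stdEnd D j r g (emb D j n M) = emb D j n (((sg (index g) r : k) * (sg (index g) j) ^ n) •
      (q D (index g) * M * (q D (index g)).transpose)) := by
  have : (stdEnd D j r g).comp (emb D j n) = (emb D j n).comp
      (((sg (index g) r : k) * (sg (index g) j) ^ n) • (LinearMap.mulLeft k (q D (index g))).comp
        (LinearMap.mulRight k (q D (index g)).transpose)) := by
    refine matrix_hom_ext fun v w => ?_
    simp only [LinearMap.comp_apply, LinearMap.smul_apply, LinearMap.mulLeft_apply,
      LinearMap.mulRight_apply]
    rw [Matrix.vecMulVec_mul, Matrix.mul_vecMulVec, Matrix.vecMul_transpose, map_smul,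
      emb_vecMulVec, emb_vecMulVec, mul_smul]
    have h : TensorProduct.map (TensorProduct.map (Matrix.toLin' (q D (index g)))
        (scaleVar (sg (index g) j : k))) (Matrix.toLin' (q D (index g)))
        ((v ⊗ₜ[k] (Polynomial.X ^ n : k[X])) ⊗ₜ[k] w) = (sg (index g) j : k) ^ n •
        (((q D (index g)).mulVec v ⊗ₜ[k] (Polynomial.X ^ n : k[X])) ⊗ₜ[k]
          (q D (index g)).mulVec w) := by
      rw [TensorProduct.map_tmul, TensorProduct.map_tmul, scaleVar_X_pow, TensorProduct.tmul_smul,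
        ← TensorProduct.smul_tmul', Matrix.toLin'_apply, Matrix.toLin'_apply]
    exact congrArg (fun f : FK2 D j => (sg (index g) r : k) • f) h
  have := LinearMap.congr_fun this M
  simpa [mul_assoc] using this

theorem exists_q_index_mul (g h : Γ) : ∃ s : k, s * s = 1 ∧
    q D (index (g * h)) = s • (q D (index g) * q D (index h)) := by
  obtain ⟨s, hs, e, -⟩ := q_mul D (index g) (index h)
  exact ⟨s, hs, by rw [index_mul, e]⟩

/-- The action of `Γ` by the operators `stdEnd`. -/
def stdAct (r : Fin 4) : Γ →* Module.End k (FK2 D j) where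
  toFun := stdEnd D j r
  map_one' := FK2_hom_ext fun n M => by
    have h : index 1 = 0 := by decide
    rw [stdEnd_emb, h, q_zero]
    simp [sg]
  map_mul' g h := FK2_hom_ext fun n M => by
    obtain ⟨s, hs, e⟩ := exists_q_index_mul D g h
    rw [Module.End.mul_apply, stdEnd_emb, stdEnd_emb, stdEnd_emb, e, sg_comm _ r, sg_comm _ j,
      index_mul, sg_mulIndex, sg_mulIndex, sg_comm r, sg_comm r, sg_comm j, sg_comm j]
    congr 1
    simp only [Matrix.transpose_smul, Matrix.transpose_mul, Matrix.smul_mul, Matrix.mul_smul,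
      smul_smul, mul_assoc, hs, mul_one]
    congr 1
    push_cast
    ring

/-- Moving qₘ past qⱼqₗ costs one sign for each factor. The sign from qⱼ has no counterpart in the
Γ-action on S; it is absorbed by the factor (±1)ⁿ in degree n of `stdEnd`. -/
theorem q_conj_rhoX (m l : Fin 4) :
    (sg m j : k) • (q D m * rhoX D j l) = (sg m l : k) • (rhoX D j l * q D m) := by
  rw [rhoX_eq, Matrix.mul_smul, ← mul_assoc, q_commute D m j, Matrix.smul_mul, mul_assoc,
    q_commute D m l, Matrix.mul_smul, Matrix.smul_mul, mul_assoc, smul_comm (kappa D j l),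
    smul_smul, sg_cast_mul_self, one_smul, smul_comm (kappa D j l)]

theorem gamma_x_tmul (g : Γ) (l : Fin 4) :
    gamma D g (x D l ⊗ₜ 1) = (sg (index g) l : k) • (x D l ⊗ₜ 1 : S' D) := by
  change (gammaS D g (x D l)) ⊗ₜ[k] (gammaM D g 1) = _
  rw [gammaS_x, map_one, ← Int.cast_smul_eq_zsmul k, ← TensorProduct.smul_tmul', sgn_eq_sg]

theorem gamma_one_tmul (g : Γ) (m : M₂ k) :
    gamma D g (1 ⊗ₜ m) = (1 ⊗ₜ (q D (index g) * m * qInv D (index g)) : S' D) := by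
  change (gammaS D g 1) ⊗ₜ[k] (gammaM D g m) = _
  rw [map_one, ← q_inv]
  rfl

theorem stdEnd_smul (r : Fin 4) (g : Γ) (z : S' D) :
    ∀ f : FK2 D j, stdEnd D j r g (z • f) = gamma D g z • stdEnd D j r g f := by
  induction z using S'_induction with
  | hadd z z' h h' => intro f; rw [add_smul, map_add, map_add, add_smul, h, h']
  | hmul z z' h h' => intro f; rw [mul_smul, map_mul, mul_smul, h, h']
  | hx l =>
    have : (stdEnd D j r g).comp (action D j (x D l ⊗ₜ 1)) =
        (action D j (gamma D g (x D l ⊗ₜ 1))).comp (stdEnd D j r g) := by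
      refine FK2_hom_ext fun n M => ?_
      simp only [LinearMap.comp_apply]
      rw [gamma_x_tmul, map_smul, LinearMap.smul_apply, ← smul_def, ← smul_def, x_smul_emb,
        stdEnd_emb, stdEnd_emb, x_smul_emb, ← map_smul]
      have := q_conj_rhoX D j (index g) l
      congr 1
      simp only [Matrix.transpose_one, mul_one]
      rw [pow_succ, ← mul_assoc, mul_smul, ← mul_assoc (q D (index g)), ← Matrix.smul_mul _ _ (q D (index g)).transpose,
        ← Matrix.smul_mul _ _ M, this]
      simp only [Matrix.smul_mul, Matrix.mul_smul, smul_smul, mul_assoc]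
      congr 1
      ring
    exact LinearMap.congr_fun this
  | hm m =>
    have : (stdEnd D j r g).comp (action D j (1 ⊗ₜ m)) =
        (action D j (gamma D g (1 ⊗ₜ m))).comp (stdEnd D j r g) := by
      refine FK2_hom_ext fun n M => ?_
      simp only [LinearMap.comp_apply]
      rw [gamma_one_tmul, ← smul_def, ← smul_def, one_smul_emb, stdEnd_emb, stdEnd_emb,
        one_smul_emb]
      congr 1
      have h : (q D (index g)).transpose * (qInv D (index g)).transpose = 1 := by
        rw [← Matrix.transpose_mul, qInv_mul_q, Matrix.transpose_one]
      simp only [Matrix.transpose_mul, Matrix.smul_mul, mul_assoc]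
      rw [← mul_assoc (q D (index g)).transpose (qInv D (index g)).transpose, h, one_mul]
    exact LinearMap.congr_fun this

/-- The standard equivariant structures. -/
def std (r : Fin 4) : EquivariantStructure D j where
  act := stdAct D j r
  act_mem g n f hf := by
    rw [← emb_coef hf]
    change stdEnd D j r g _ ∈ _
    rw [stdEnd_emb]
    exact emb_mem _ _ _ _
  act_smul g z f := stdEnd_smul D j r g z f

theorem std_act_emb (r : Fin 4) (g : Γ) (n : ℕ) (M : M₂ k) :
    (std D j r).act g (emb D j n M) = emb D j n (((sg (index g) r : k) * (sg (index g) j) ^ n) •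
      (q D (index g) * M * (q D (index g)).transpose)) := stdEnd_emb D j r g n M

/-! ### Classification of the equivariant structures -/

variable {D j}

/-- A graded form of Schur's lemma: the M₂(k)-factor reduces φ to a left multiplication in each
degree, and the S-factor makes these multiplications one and the same scalar. -/
theorem exists_smul_of_graded_endomorphism (h2 : (2 : k) ≠ 0) (φ : FK2 D j →ₗ[k] FK2 D j)
    (hdeg : ∀ n, ∀ f ∈ degFK2 D j n, φ f ∈ degFK2 D j n)
    (hsmul : ∀ (z : S' D) f, φ (z • f) = z • φ f) : ∃ c : k, φ = c • LinearMap.id := by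
  set P : ℕ → M₂ k := fun n => coef D j n (φ (emb D j n 1)) with hP
  have hφ : ∀ n M, φ (emb D j n M) = emb D j n (P n * M) := fun n M => by
    have := hsmul (1 ⊗ₜ M.transpose) (emb D j n 1)
    rw [one_smul_emb, ← emb_coef (hdeg n _ (emb_mem D j n 1)), one_smul_emb,
      Matrix.transpose_transpose, one_mul] at this
    exact this
  have hρ : ∀ n l, P (n + 1) * rhoX D j l = rhoX D j l * P n := fun n l => by
    have := hsmul (x D l ⊗ₜ 1) (emb D j n 1)
    rw [x_smul_emb, hφ, hφ, x_smul_emb] at this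
    simpa using emb_injective D j _ this
  -- The generator xⱼ acts on V(τ+ξⱼ) by a nonzero scalar, which links consecutive degrees without
  -- changing the matrix.
  have hj : ∃ t : k, t ≠ 0 ∧ rhoX D j j = t • 1 := by
    have := i_ne_zero D
    fin_cases j
    · exact ⟨1, one_ne_zero, by simp [rhoX]⟩
    all_goals exact ⟨-D.i, neg_ne_zero.2 this, by simp [rhoX]⟩
  obtain ⟨t, ht, hj⟩ := hj
  have hsucc : ∀ n, P (n + 1) = P n := fun n => by
    have := hρ n j
    rw [hj, Matrix.mul_smul, Matrix.smul_mul, mul_one, one_mul] at this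
    exact smul_right_injective _ ht this
  have hn : ∀ n, P n = P 0 := fun n => by
    induction n with
    | zero => rfl
    | succ n ih => rw [hsucc, ih]
  have hq : ∀ l, P 0 * (q D j * q D l) = q D j * q D l * P 0 := fun l => by
    have := hρ 0 l
    rw [hn 1, rhoX_eq, Matrix.mul_smul, Matrix.smul_mul] at this
    exact smul_right_injective _ (kappa_ne_zero D j l) this
  have hq' : ∀ l, P 0 * q D l = q D l * P 0 := fun l => by
    -- The case l = 0 gives commutation with qⱼ, which can then be cancelled in the remaining cases.
    have h0 := hq 0
    rw [q_zero, mul_one] at h0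
    have := hq l
    rw [← mul_assoc, h0, mul_assoc, mul_assoc] at this
    exact (isUnit_q D j).mul_right_injective this
  refine ⟨P 0 0 0, FK2_hom_ext fun n M => ?_⟩
  rw [hφ, hn, eq_smul_one_of_commute D h2 (P 0) (hq' 1) (hq' 3), Matrix.smul_mul, one_mul, map_smul]
  simp

theorem act_act (σ : EquivariantStructure D j) (g : Γ) (f : FK2 D j) :
    σ.act g (σ.act g f) = f := by
  rw [← Module.End.mul_apply, ← map_mul, gamma_mul_self, map_one]; rfl

theorem gamma_gamma (g : Γ) (z : S' D) : gamma D g (gamma D g z) = z := by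
  rw [← AlgHom.mul_apply, ← map_mul, gamma_mul_self, map_one]; rfl

/-- A character of Γ takes values ±1 and is determined by its values on the two generators; the four
sign patterns are those of the four columns of `sg`. -/
theorem exists_sg_eq {c : Γ → k} (hc : ∀ g h, c (g * h) = c g * c h) (h1 : c 1 = 1) :
    ∃ r, ∀ g, c g = sg (index g) r := by
  have hsq : ∀ g, c g = 1 ∨ c g = -1 := fun g => by
    rw [← mul_self_eq_one_iff, ← hc, gamma_mul_self, h1]
  have key : ∀ r : Fin 4, c (.ofAdd (1, 0)) = sg 1 r → c (.ofAdd (0, 1)) = sg 2 r →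
      ∀ g, c g = sg (index g) r := fun r e1 e2 g => by
    have e3 : c (.ofAdd (1, 1)) = sg 3 r := by
      have h : (.ofAdd (1, 1) : Γ) = .ofAdd (1, 0) * .ofAdd (0, 1) := by decide
      have hs : sg 3 r = sg 1 r * sg 2 r := by clear e1 e2; revert r; decide
      rw [h, hc, e1, e2, hs, Int.cast_mul]
    have hg : g = 1 ∨ g = .ofAdd (1, 0) ∨ g = .ofAdd (0, 1) ∨ g = .ofAdd (1, 1) := by
      revert g; decide
    rcases hg with rfl | rfl | rfl | rfl
    · have h0 : index 1 = 0 := by decide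
      rw [h1, h0]; simp [sg]
    · exact e1
    · exact e2
    · exact e3
  rcases hsq (.ofAdd (1, 0)) with e1 | e1 <;> rcases hsq (.ofAdd (0, 1)) with e2 | e2
  · exact ⟨0, key 0 (by simp [e1, sg]) (by simp [e2, sg])⟩
  · exact ⟨1, key 1 (by simp [e1, sg]) (by simp [e2, sg])⟩
  · exact ⟨2, key 2 (by simp [e1, sg]) (by simp [e2, sg])⟩
  · exact ⟨3, key 3 (by simp [e1, sg]) (by simp [e2, sg])⟩

theorem eq_std (h2 : (2 : k) ≠ 0) (σ : EquivariantStructure D j) : ∃ r, σ = std D j r := by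
  -- Both operators are semilinear over the same involution of S', so their composite is S'-linear
  -- and therefore scalar.
  have hc : ∀ g, ∃ c : k, ∀ f, σ.act g f = c • (std D j 0).act g f := fun g => by
    obtain ⟨c, hc⟩ := exists_smul_of_graded_endomorphism h2 ((std D j 0).act g * σ.act g)
      (fun n f hf => (std D j 0).act_mem g n _ (σ.act_mem g n f hf)) fun z f => by
        rw [Module.End.mul_apply, σ.act_smul, (std D j 0).act_smul, gamma_gamma]; rfl
    refine ⟨c, fun f => ?_⟩
    have := congrArg ((std D j 0).act g) (LinearMap.congr_fun hc f)
    rwa [Module.End.mul_apply, act_act, LinearMap.smul_apply, map_smul] at this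
  choose c hc using hc
  have hinj : ∀ (s t : k), s • emb D j 0 1 = t • emb D j 0 1 → s = t := fun s t h => by
    rw [← map_smul, ← map_smul] at h
    simpa using congrFun (congrFun (emb_injective D j 0 h) 0) 0
  have h1 : c 1 = 1 := by
    have := hc 1 (emb D j 0 1)
    rw [map_one σ.act, map_one (std D j 0).act, Module.End.one_apply] at this
    exact hinj _ _ (this.symm.trans (one_smul _ _).symm)
  have hmul : ∀ g h, c (g * h) = c g * c h := fun g h => by
    refine hinj _ _ ?_
    have := hc (g * h) ((std D j 0).act (g * h) (emb D j 0 1))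
    rw [act_act] at this
    rw [← this, map_mul σ.act, Module.End.mul_apply, hc h, map_smul, hc g,
      ← Module.End.mul_apply ((std D j 0).act g), ← map_mul, act_act, smul_smul, mul_comm]
  obtain ⟨r, hr⟩ := exists_sg_eq hmul h1
  refine ⟨r, ?_⟩
  have : σ.act = (std D j r).act := by
    refine MonoidHom.ext fun g => FK2_hom_ext fun n M => ?_
    rw [hc, std_act_emb, std_act_emb, ← map_smul, smul_smul, hr, sg_zero]
    simp
  cases σ
  simp only at this
  subst this
  rfl

/-- An isomorphism is a nonzero scalar, so it cannot change the action; the characters are read off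
in degree 0 from the identity matrix. -/
theorem eq_of_std_iso (h2 : (2 : k) ≠ 0) {r r' : Fin 4} (h : (std D j r).Iso (std D j r')) :
    r = r' := by
  obtain ⟨e, hdeg, he⟩ := h
  obtain ⟨c, hc⟩ := exists_smul_of_graded_endomorphism h2
    ((e : FK2 D j →ₗ[S' D] FK2 D j).restrictScalars k) (fun n f hf => (hdeg n f).1 hf)
    fun z f => map_smul e z f
  have hc : ∀ f, e f = c • f := LinearMap.congr_fun hc
  have hc0 : c ≠ 0 := by
    rintro rfl
    have h := (hc (emb D j 0 1)).trans (zero_smul _ _)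
    rw [LinearEquiv.map_eq_zero_iff, ← map_zero (emb D j 0)] at h
    exact one_ne_zero (emb_injective D j 0 h)
  refine sg_cast_injective h2 fun l => ?_
  obtain ⟨g, rfl⟩ := index_surjective l
  have := he g (emb D j 0 1)
  rw [hc, hc, map_smul] at this
  have := smul_right_injective _ hc0 this
  rw [std_act_emb, std_act_emb] at this
  have := emb_injective D j 0 this
  rw [pow_zero, mul_one, mul_one, mul_one] at this
  have hu := (isUnit_q D (index g)).mul ((Matrix.isUnit_transpose _).2 (isUnit_q D (index g)))
  by_contra hne
  have h0 : ((sg (index g) r : k) - sg (index g) r') • (q D (index g) *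
      (q D (index g)).transpose) = 0 := by rw [sub_smul, this, sub_self]
  rcases smul_eq_zero.1 h0 with h0 | h0
  · exact hne (sub_eq_zero.1 h0)
  · exact hu.ne_zero h0

theorem card_quotient (h2 : (2 : k) ≠ 0) :
    Nat.card (Quotient (EquivariantStructure.setoid D j)) = 4 := by
  have : Function.Bijective fun r : Fin 4 =>
      (Quotient.mk (EquivariantStructure.setoid D j) (std D j r)) := by
    constructor
    · intro r r' h
      exact eq_of_std_iso h2 (Quotient.exact h)
    · intro σ
      induction σ using Quotient.inductionOn with
      | h σ => obtain ⟨r, rfl⟩ := eq_std h2 σ; exact ⟨r, rfl⟩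
  rw [← Nat.card_eq_of_bijective _ this, Nat.card_eq_fintype_card, Fintype.card_fin]

end

section

variable {k : Type*} [Field k] (D : Parameters k)

/-! ### Generators of `A` -/

/-- The span of `y₀, y₁, y₂, y₃`. -/
def spanY : Submodule k (A D) := Submodule.span k (Set.range (y D))

/-- The elements of `S` of weight `l` whose product with `q l` is a form of degree `n` in the
`yₙ`. -/
def weightPart (n : ℕ) (l : Fin 4) : Submodule k (S D) where
  carrier := {s | s ⊗ₜ[k] q D l ∈ (spanY D ^ n).map (A D).val.toLinearMap ∧
    ∀ g, gammaS D g s = (sg (index g) l : k) • s}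
  zero_mem' := ⟨by rw [TensorProduct.zero_tmul]; exact zero_mem _, fun g => by simp⟩
  add_mem' := fun ⟨h1, h2⟩ ⟨h1', h2'⟩ => ⟨by rw [TensorProduct.add_tmul]; exact add_mem h1 h1',
    fun g => by rw [map_add, h2, h2', smul_add]⟩
  smul_mem' := fun r s ⟨h1, h2⟩ => ⟨by
    rw [← TensorProduct.smul_tmul']; exact Submodule.smul_mem _ r h1,
    fun g => by rw [map_smul, h2, smul_comm]⟩

theorem x_mul_mem_weightPart {n : ℕ} {l : Fin 4} (m : Fin 4) {s : S D}
    (hs : s ∈ weightPart D n l) : x D m * s ∈ weightPart D (n + 1) (mulIndex m l) := by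
  obtain ⟨⟨f, hf, hfs⟩, h2⟩ := hs
  obtain ⟨t, -, ht, -⟩ := q_mul D m l
  refine ⟨⟨t • (y D m * f), Submodule.smul_mem _ _ ?_, ?_⟩, fun g => ?_⟩
  · rw [pow_succ']
    exact Submodule.mul_mem_mul (Submodule.subset_span ⟨m, rfl⟩) hf
  · rw [map_smul, ht, TensorProduct.tmul_smul]
    change t • ((x D m ⊗ₜ q D m : S' D) * (f : S' D)) = _
    have : (f : S' D) = s ⊗ₜ q D l := hfs
    rw [this, Algebra.TensorProduct.tmul_mul_tmul]
  · rw [map_mul, h2, gammaS_x, sgn_eq_sg, sg_mulIndex, ← Int.cast_smul_eq_zsmul k, smul_mul_smul_comm,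
      Int.cast_mul]

/-- A monomial in the xₗ, tensored with the product of the corresponding qₗ, is the same monomial in
the yₗ; that product of q's is, up to sign, a single q whose index records the weight of the
monomial. -/
theorem degS_le_iSup_weightPart (n : ℕ) : degS D n ≤ ⨆ l, weightPart D n l := by
  induction n with
  | zero =>
    rw [degS, pow_zero, Submodule.one_le]
    refine Submodule.mem_iSup_of_mem 0 ⟨⟨1, ?_, ?_⟩, fun g => ?_⟩
    · rw [pow_zero]; exact Submodule.one_le.1 le_rfl
    · rw [q_zero]; rfl
    · rw [map_one, sg_zero, Int.cast_one, one_smul]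
  | succ n ih =>
    rw [degS, pow_succ', Submodule.mul_le]
    intro a ha s hs
    induction ha using Submodule.span_induction with
    | mem a ha =>
      obtain ⟨m, rfl⟩ := ha
      replace hs := ih hs
      induction hs using Submodule.iSup_induction' with
      | zero => rw [mul_zero]; exact zero_mem _
      | add s t _ _ hs ht => rw [mul_add]; exact add_mem hs ht
      | mem l s hs => exact Submodule.mem_iSup_of_mem _ (x_mul_mem_weightPart D m hs)
    | zero => rw [zero_mul]; exact zero_mem _
    | add a b _ _ ha hb => rw [add_mul]; exact add_mem ha hb
    | smul r a _ ha => rw [smul_mul_assoc]; exact Submodule.smul_mem _ r ha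

theorem iSup_degS : ⨆ n, degS D n = ⊤ := by
  refine top_unique ?_
  have h := congrArg Subalgebra.toSubmodule (adjoin_range_x D)
  rw [Algebra.adjoin_eq_span, Algebra.top_toSubmodule] at h
  rw [← h, Submodule.span_le]
  intro s hs
  have : ∃ n, s ∈ degS D n := by
    induction hs using Submonoid.closure_induction with
    | mem s hs => obtain ⟨l, rfl⟩ := hs; exact ⟨1, x_mem_degS D l⟩
    | one => exact ⟨0, one_mem_degS D⟩
    | mul s t _ _ hs ht =>
      obtain ⟨m, hm⟩ := hs
      obtain ⟨n, hn⟩ := ht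
      exact ⟨m + n, by rw [degS, pow_add]; exact Submodule.mul_mem_mul hm hn⟩
  obtain ⟨n, hn⟩ := this
  exact Submodule.mem_iSup_of_mem n hn

/-- Expand s into weight vectors and m into the q's: averaging kills every term whose two weights
differ, and the surviving terms are forms in the yₗ. -/
theorem sum_gamma_tmul_mem (h2 : (2 : k) ≠ 0) (n : ℕ) {s : S D} (hs : s ∈ degS D n) (m : M₂ k) :
    ∑ g, gamma D g (s ⊗ₜ m) ∈ (spanY D ^ n).map (A D).val.toLinearMap := by
  obtain ⟨c, rfl⟩ := exists_eq_sum_q D h2 m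
  replace hs := degS_le_iSup_weightPart D n hs
  induction hs using Submodule.iSup_induction' with
  | zero => simp
  | add s t _ _ hs ht =>
    simp only [TensorProduct.add_tmul, map_add, Finset.sum_add_distrib]
    exact add_mem hs ht
  | mem l s hs =>
    simp only [TensorProduct.tmul_sum, map_sum, TensorProduct.tmul_smul, map_smul]
    rw [Finset.sum_comm]
    refine Submodule.sum_mem _ fun l' _ => ?_
    rw [← Finset.smul_sum]
    refine Submodule.smul_mem _ _ ?_
    have h : ∀ g, gamma D g (s ⊗ₜ q D l') =
        ((sg (index g) l * sg (index g) l' : ℤ) : k) • (s ⊗ₜ q D l' : S' D) := fun g => by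
      change (gammaS D g s) ⊗ₜ[k] (gammaM D g (q D l')) = _
      rw [hs.2, gammaM_q, ← Int.cast_smul_eq_zsmul k, TensorProduct.smul_tmul_smul, Int.cast_mul,
        sgn_eq_sg]
    simp only [h]
    rw [← Finset.sum_smul, ← Int.cast_sum]
    -- Orthogonality of the characters of Γ.
    have horth : ∑ g : Γ, sg (index g) l * sg (index g) l' = if l = l' then 4 else 0 := by
      have key : ∀ l l', ∑ g : Γ, sg (index g) l * sg (index g) l' = if l = l' then 4 else 0 := by
        decide
      exact key l l'
    rw [horth]
    split_ifs with hl
    · subst hl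
      exact Submodule.smul_mem _ _ hs.1
    · rw [Int.cast_zero, zero_smul]; exact zero_mem _

/-- The sum over Γ multiplies an invariant by |Γ| = 4, which is invertible. -/
theorem mem_of_sum_gamma_mem (h2 : (2 : k) ≠ 0) {P : Submodule k (A D)} (z : A D)
    (h : ∑ g, gamma D g z ∈ P.map (A D).val.toLinearMap) : z ∈ P := by
  have h4 : (4 : k) ≠ 0 := by
    have : (4 : k) = 2 * 2 := by norm_num
    rw [this]; exact mul_ne_zero h2 h2
  have e : ∑ g, gamma D g z = ((4 : k) • z : A D) := by
    have : ∀ g, gamma D g (z : S' D) = z := z.2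
    simp only [this, Finset.sum_const, Finset.card_univ]
    have : Fintype.card Γ = 4 := by decide
    rw [this, ← Nat.cast_smul_eq_nsmul k]
    norm_num
  rw [e] at h
  obtain ⟨z', hz', hzz⟩ := h
  have : z' = (4 : k) • z := Subtype.ext hzz
  rw [this] at hz'
  exact (Submodule.smul_mem_iff _ h4).1 hz'

theorem degS'_mul_mem {m n : ℕ} {z z' : S' D} (hz : z ∈ degS' D m) (hz' : z' ∈ degS' D n) :
    z * z' ∈ degS' D (m + n) := by
  have h : degS' D m * degS' D n ≤ degS' D (m + n) := by
    rw [degS', degS', Submodule.span_mul_span, Submodule.span_le]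
    rintro _ ⟨_, ⟨s, hs, a, rfl⟩, _, ⟨t, ht, b, rfl⟩, rfl⟩
    refine Submodule.subset_span ⟨s * t, ?_, a * b, Algebra.TensorProduct.tmul_mul_tmul _ _ _ _⟩
    rw [degS, pow_add]
    exact Submodule.mul_mem_mul hs ht
  exact h (Submodule.mul_mem_mul hz hz')

theorem degA_eq (h2 : (2 : k) ≠ 0) (n : ℕ) : degA D n = spanY D ^ n := by
  apply le_antisymm
  · intro z hz
    refine mem_of_sum_gamma_mem D h2 z ?_
    have hz : (z : S' D) ∈ degS' D n := hz
    -- Invariance is forgotten here: the statement about the sum over Γ makes sense for every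
    -- element of S'ₙ and is linear in it.
    generalize (z : S' D) = z' at hz
    induction hz using Submodule.span_induction with
    | mem z hz => obtain ⟨s, hs, m, rfl⟩ := hz; exact sum_gamma_tmul_mem D h2 n hs m
    | zero => simp
    | add z z' _ _ h h' =>
      simp only [map_add, Finset.sum_add_distrib]
      exact add_mem h h'
    | smul r z _ h =>
      simp only [map_smul, ← Finset.smul_sum]
      exact Submodule.smul_mem _ r h
  · induction n with
    | zero =>
      rw [pow_zero, Submodule.one_le]
      exact Submodule.subset_span ⟨1, one_mem_degS D, 1, rfl⟩
    | succ n ih =>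
      rw [pow_succ, Submodule.mul_le]
      intro z hz z' hz'
      refine degS'_mul_mem D (ih hz) ?_
      have : spanY D ≤ degA D 1 := by
        refine Submodule.span_le.2 ?_
        rintro _ ⟨l, rfl⟩
        exact Submodule.subset_span ⟨_, x_mem_degS D l, _, rfl⟩
      exact this hz'

theorem iSup_spanY_pow (h2 : (2 : k) ≠ 0) : ⨆ n, spanY D ^ n = ⊤ := by
  refine Submodule.eq_top_iff'.2 fun z => mem_of_sum_gamma_mem D h2 z ?_
  generalize (z : S' D) = z'
  induction z' using TensorProduct.induction_on with
  | zero => simp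
  | add z z' h h' =>
    simp only [map_add, Finset.sum_add_distrib]
    exact add_mem h h'
  | tmul s m =>
    have hs : s ∈ ⨆ n, degS D n := by rw [iSup_degS]; trivial
    induction hs using Submodule.iSup_induction' with
    | zero => simp
    | add s t _ _ hs ht =>
      simp only [TensorProduct.add_tmul, map_add, Finset.sum_add_distrib]
      exact add_mem hs ht
    | mem n s hs =>
      exact Submodule.map_mono (le_iSup (fun n => spanY D ^ n) n) (sum_gamma_tmul_mem D h2 n hs m)

/-! ### Relations of `A` -/

theorem y_mul (l m : Fin 4) : ((y D l * y D m : A D) : S' D) =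
    (x D l * x D m) ⊗ₜ (q D l * q D m) := Algebra.TensorProduct.tmul_mul_tmul _ _ _ _

/-- Since qₛ and qₜ anticommute, passing from the x's to the y's interchanges the symmetric and the
antisymmetric combination on the right-hand side. -/
theorem y_comm_of {r s t : Fin 4} {a : k} (h1 : q D s * q D t = q D r)
    (h2 : q D t * q D s = -q D r)
    (h : x D 0 * x D r - x D r * x D 0 = a • (x D s * x D t + x D t * x D s)) :
    y D 0 * y D r - y D r * y D 0 = a • (y D s * y D t - y D t * y D s) := by
  apply Subtype.ext
  simp only [Subalgebra.coe_sub, Subalgebra.coe_smul, y_mul, q_zero, one_mul, mul_one, h1, h2,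
    TensorProduct.tmul_neg]
  rw [← TensorProduct.sub_tmul, h]
  simp only [TensorProduct.add_tmul, TensorProduct.smul_tmul', smul_add, sub_eq_add_neg, neg_neg]

theorem y_anti_of {r s t : Fin 4} (h1 : q D s * q D t = q D r) (h2 : q D t * q D s = -q D r)
    (h : x D 0 * x D r + x D r * x D 0 = x D s * x D t - x D t * x D s) :
    y D 0 * y D r + y D r * y D 0 = y D s * y D t + y D t * y D s := by
  apply Subtype.ext
  simp only [Subalgebra.coe_add, y_mul, q_zero, one_mul, mul_one, h1, h2, TensorProduct.tmul_neg]
  rw [← TensorProduct.add_tmul, h, TensorProduct.sub_tmul, sub_eq_add_neg]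

theorem y_comm :
    y D 0 * y D 1 - y D 1 * y D 0 = D.α • (y D 2 * y D 3 - y D 3 * y D 2) ∧
    y D 0 * y D 2 - y D 2 * y D 0 = D.β • (y D 3 * y D 1 - y D 1 * y D 3) ∧
    y D 0 * y D 3 - y D 3 * y D 0 = D.γ • (y D 1 * y D 2 - y D 2 * y D 1) := by
  obtain ⟨h12, h23, h31, h21, h32, h13⟩ := q_mul_table D
  have e1 := S_rel D (Rel.comm₁ (D := D))
  have e2 := S_rel D (Rel.comm₂ (D := D))
  have e3 := S_rel D (Rel.comm₃ (D := D))
  simp only [map_sub, map_add, map_mul, map_smul, FreeAlgebra.lift_ι_apply] at e1 e2 e3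
  exact ⟨y_comm_of D h23 h32 e1, y_comm_of D h31 h13 e2, y_comm_of D h12 h21 e3⟩

theorem y_anti :
    y D 0 * y D 1 + y D 1 * y D 0 = y D 2 * y D 3 + y D 3 * y D 2 ∧
    y D 0 * y D 2 + y D 2 * y D 0 = y D 3 * y D 1 + y D 1 * y D 3 ∧
    y D 0 * y D 3 + y D 3 * y D 0 = y D 1 * y D 2 + y D 2 * y D 1 := by
  obtain ⟨h12, h23, h31, h21, h32, h13⟩ := q_mul_table D
  have e1 := S_rel D (Rel.anti₁ (D := D))
  have e2 := S_rel D (Rel.anti₂ (D := D))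
  have e3 := S_rel D (Rel.anti₃ (D := D))
  simp only [map_sub, map_add, map_mul, FreeAlgebra.lift_ι_apply] at e1 e2 e3
  exact ⟨y_anti_of D h23 h32 e1, y_anti_of D h31 h13 e2, y_anti_of D h12 h21 e3⟩

end

section

variable {k : Type*} [Field k] (D : Parameters k)

/-! ### The multiplication rule in the point modules -/

/-- Adding two of the equations leaves twice a single v l on one side and 2 v₀ on the other. -/
theorem eq_of_add_eq_add (h2 : (2 : k) ≠ 0) {N : Type*} [AddCommGroup N] [Module k N]
    {v : Fin 4 → N} (e1 : v 0 + v 1 = v 2 + v 3) (e2 : v 0 + v 2 = v 3 + v 1)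
    (e3 : v 0 + v 3 = v 1 + v 2) (l : Fin 4) : v l = v 0 := by
  have h : ∀ l, (2 : k) • v l = (2 : k) • v 0 → v l = v 0 := fun l h =>
    smul_right_injective _ h2 h
  have h1 := h 1 (by linear_combination (norm := module) -e2 - e3)
  have h2 := h 2 (by linear_combination (norm := module) -e1 - e3)
  have h3 := h 3 (by linear_combination (norm := module) -e1 - e2)
  fin_cases l
  exacts [rfl, h1, h2, h3]

/-- The linear equations satisfied by the elements `y l • e` when `y l • e' = p l • e`. -/
structure PointEquations {N : Type*} [AddCommGroup N] [Module k N] (p : Fin 4 → k)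
    (w : Fin 4 → N) : Prop where
  comm₁ : p 1 • w 0 - p 0 • w 1 = D.α • (p 3 • w 2 - p 2 • w 3)
  comm₂ : p 2 • w 0 - p 0 • w 2 = D.β • (p 1 • w 3 - p 3 • w 1)
  comm₃ : p 3 • w 0 - p 0 • w 3 = D.γ • (p 2 • w 1 - p 1 • w 2)
  anti₁ : p 1 • w 0 + p 0 • w 1 = p 3 • w 2 + p 2 • w 3
  anti₂ : p 2 • w 0 + p 0 • w 2 = p 1 • w 3 + p 3 • w 1
  anti₃ : p 3 • w 0 + p 0 • w 3 = p 2 • w 1 + p 1 • w 2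

theorem pointEquations {N : Type*} [AddCommGroup N] [Module k N] [Module (A D) N]
    [IsScalarTower k (A D) N] {p : Fin 4 → k} {e e' : N} (h : ∀ l, y D l • e' = p l • e) :
    PointEquations D p fun l => y D l • e := by
  have hyy : ∀ l m, (y D l * y D m) • e' = p m • y D l • e := fun l m => by
    rw [mul_smul, h, ← algebraMap_smul (A D) (p m) e, ← algebraMap_smul (A D) (p m) (y D l • e),
      smul_smul, smul_smul, Algebra.commutes]
  obtain ⟨c1, c2, c3⟩ := y_comm D
  obtain ⟨a1, a2, a3⟩ := y_anti D
  constructor <;> [have H := c1; have H := c2; have H := c3; have H := a1; have H := a2;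
    have H := a3] <;>
    simpa only [sub_smul, add_smul, smul_assoc, hyy] using congrArg (fun z : A D => z • e') H

/-- The expected solution is κⱼ twisted by the character with index j. Dividing w by it leaves
unknowns v l that have to be shown equal. For j = 0 the three anticommutator equations do this; for
j ≠ 0 the j-th anticommutator equation and the other two commutator equations do. -/
theorem PointEquations.exists_eq_smul_kappa (hk : (2 : k) ≠ 0) {N : Type*} [AddCommGroup N]
    [Module k N] {j : Fin 4} {w : Fin 4 → N} (h : PointEquations D (kappa D j) w) :
    ∃ v, ∀ l, w l = coord D j j l • v := by
  obtain ⟨v, hv⟩ : ∃ v : Fin 4 → N, ∀ l, w l = coord D j j l • v l :=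
    ⟨fun l => (coord D j j l)⁻¹ • w l, fun l => by rw [smul_inv_smul₀ (coord_ne_zero D j j l)]⟩
  have hi := D.i_sq
  have ha := D.a_sq
  have hb := D.b_sq
  have hc := D.c_sq
  have hcancel : ∀ r (a b : N), (kappa D j 0 * kappa D j r) • a = (kappa D j 0 * kappa D j r) • b →
    a = b := fun r a b h =>
    smul_right_injective _ (mul_ne_zero (kappa_ne_zero D j 0) (kappa_ne_zero D j r)) h
  have h1 := hcancel 1 (v 0 + v 1) (v 2 + v 3)
  have h2 := hcancel 2 (v 0 + v 2) (v 3 + v 1)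
  have h3 := hcancel 3 (v 0 + v 3) (v 1 + v 2)
  obtain ⟨c1, c2, c3, a1, a2, a3⟩ := h
  simp only [hv] at c1 c2 c3 a1 a2 a3
  have e : v 0 + v 1 = v 2 + v 3 ∧ v 0 + v 2 = v 3 + v 1 ∧ v 0 + v 3 = v 1 + v 2 := by
    clear hv hcancel
    fin_cases j <;> simp [kappa, coord, sg] at c1 c2 c3 a1 a2 a3 h1 h2 h3 ⊢
    · exact ⟨a1, a2, a3⟩
    · exact ⟨h1 (by linear_combination (norm := skip) a1; match_scalars <;> grind only),
        h2 (by linear_combination (norm := skip) c2; match_scalars <;> grind only),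
        h3 (by linear_combination (norm := skip) c3; match_scalars <;> grind only)⟩
    · exact ⟨h1 (by linear_combination (norm := skip) c1; match_scalars <;> grind only),
        h2 (by linear_combination (norm := skip) a2; match_scalars <;> grind only),
        h3 (by linear_combination (norm := skip) c3; match_scalars <;> grind only)⟩
    · exact ⟨h1 (by linear_combination (norm := skip) c1; match_scalars <;> grind only),
        h2 (by linear_combination (norm := skip) c2; match_scalars <;> grind only),
        h3 (by linear_combination (norm := skip) a3; match_scalars <;> grind only)⟩
  exact ⟨v 0, fun l => by rw [hv, eq_of_add_eq_add hk e.1 e.2.1 e.2.2 l]⟩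

/-- The relations of A are preserved when each yₗ is multiplied by the sign `sg l r`, which reduces
every point of 𝔓ⱼ to κⱼ. -/
theorem PointEquations.exists_eq_smul_coord (h2 : (2 : k) ≠ 0) {N : Type*} [AddCommGroup N]
    [Module k N] {j r : Fin 4} {w : Fin 4 → N} (h : PointEquations D (coord D j r) w) :
    ∃ v, ∀ l, w l = coord D j (mulIndex j r) l • v := by
  have h' : PointEquations D (kappa D j) fun l => (sg l r : k) • w l := by
    obtain ⟨c1, c2, c3, a1, a2, a3⟩ := h
    have hs : sg 1 r * sg 2 r = sg 3 r ∧ sg 2 r * sg 3 r = sg 1 r ∧ sg 3 r * sg 1 r = sg 2 r := by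
      clear c1 c2 c3 a1 a2 a3; revert r; decide
    obtain ⟨e3, e1, e2⟩ := hs
    replace e1 := congrArg (Int.cast : ℤ → k) e1
    replace e2 := congrArg (Int.cast : ℤ → k) e2
    replace e3 := congrArg (Int.cast : ℤ → k) e3
    push_cast at e1 e2 e3
    have h0 : (sg 0 r : k) = 1 := by simp [sg]
    have h1 := sg_cast_mul_self (k := k) 1 r
    have h2 := sg_cast_mul_self (k := k) 2 r
    have h3 := sg_cast_mul_self (k := k) 3 r
    simp only [coord, h0] at c1 c2 c3 a1 a2 a3
    constructor
    · linear_combination (norm := skip) (sg 1 r : k) • c1; match_scalars <;> grind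
    · linear_combination (norm := skip) (sg 2 r : k) • c2; match_scalars <;> grind
    · linear_combination (norm := skip) (sg 3 r : k) • c3; match_scalars <;> grind
    · linear_combination (norm := skip) (sg 1 r : k) • a1; match_scalars <;> grind
    · linear_combination (norm := skip) (sg 2 r : k) • a2; match_scalars <;> grind
    · linear_combination (norm := skip) (sg 3 r : k) • a3; match_scalars <;> grind
  obtain ⟨v, hv⟩ := h'.exists_eq_smul_kappa D h2
  refine ⟨v, fun l => ?_⟩
  have := congrArg ((sg l r : k) • ·) (hv l)
  simp only [smul_smul, sg_cast_mul_self, one_smul] at this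
  rw [this]
  congr 1
  simp only [coord, sg_mulIndex, Int.cast_mul]
  ring

end

section

variable {k : Type*} [Field k] (D : Parameters k)

/-! ### Bases of the point modules -/

/-- The index of the point obtained from the one with index `r` by `n` degree shifts. -/
def orbit (j r : Fin 4) : ℕ → Fin 4
  | 0 => r
  | n + 1 => mulIndex j (orbit j r n)

/-- A sequence of elements that are multiplied by the `yₗ` as a homogeneous basis of a point
module. -/
def IsPointSequence {N : Type*} [AddCommGroup N] [Module k N] [Module (A D) N] (j r : Fin 4)
    (e : ℕ → N) : Prop :=
  ∀ n l, y D l • e n = coord D j (orbit j r n) l • e (n + 1)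

variable {D}

namespace IsPointSequence

variable {N : Type*} [AddCommGroup N] [Module k N] [Module (A D) N] [IsScalarTower k (A D) N]
  {j r : Fin 4} {e : ℕ → N}

theorem smul_mem_span (h : IsPointSequence D j r e) {m : ℕ} {z : A D} (hz : z ∈ spanY D ^ m)
    (n : ℕ) : z • e n ∈ Submodule.span k {e (m + n)} := by
  induction hz using Submodule.pow_induction_on_left' with
  | algebraMap s =>
    rw [algebraMap_smul, zero_add]
    exact Submodule.smul_mem _ _ (Submodule.mem_span_singleton_self _)
  | add z z' m _ _ hz hz' => rw [add_smul]; exact add_mem hz hz'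
  | mem_mul a ha m z _ hz =>
    obtain ⟨c, hc⟩ := Submodule.mem_span_singleton.1 hz
    rw [mul_smul, ← hc]
    induction ha using Submodule.span_induction with
    | mem a ha =>
      obtain ⟨l, rfl⟩ := ha
      rw [← algebraMap_smul (A D) c, smul_smul, ← Algebra.commutes, mul_smul, algebraMap_smul, h,
        Nat.succ_eq_add_one, add_right_comm]
      exact Submodule.smul_mem _ _ (Submodule.smul_mem _ _ (Submodule.mem_span_singleton_self _))
    | zero => rw [zero_smul]; exact zero_mem _
    | add a b _ _ ha hb => rw [add_smul]; exact add_mem ha hb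
    | smul s a _ ha => rw [smul_assoc]; exact Submodule.smul_mem _ _ ha

theorem y_smul_smul (h : IsPointSequence D j r e) (n : ℕ) (l : Fin 4) (c : k) :
    y D l • c • e n = (c * coord D j (orbit j r n) l) • e (n + 1) := by
  rw [← algebraMap_smul (A D) c, smul_smul, ← Algebra.commutes, mul_smul, algebraMap_smul, h,
    smul_smul]

theorem exists_smul_eq (h : IsPointSequence D j r e) (n : ℕ) :
    ∃ z ∈ spanY D ^ n, z • e 0 = e n := by
  induction n with
  | zero => exact ⟨1, by rw [pow_zero]; exact Submodule.one_le.1 le_rfl, one_smul _ _⟩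
  | succ n ih =>
    obtain ⟨z, hz, hze⟩ := ih
    refine ⟨(coord D j (orbit j r n) 0)⁻¹ • (y D 0 * z), Submodule.smul_mem _ _ ?_, ?_⟩
    · rw [pow_succ']
      exact Submodule.mul_mem_mul (Submodule.subset_span ⟨0, rfl⟩) hz
    · rw [smul_assoc, mul_smul, hze, h, inv_smul_smul₀ (coord_ne_zero _ _ _ _)]

theorem span_eq_top (h2 : (2 : k) ≠ 0) (h : IsPointSequence D j r e)
    (h0 : ∀ f, ∃ z : A D, f = z • e 0) : Submodule.span k (Set.range e) = ⊤ := by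
  refine Submodule.eq_top_iff'.2 fun f => ?_
  obtain ⟨z, rfl⟩ := h0 f
  have hz : z ∈ ⨆ n, spanY D ^ n := by rw [iSup_spanY_pow D h2]; trivial
  induction hz using Submodule.iSup_induction' with
  | mem n z hz =>
    refine Submodule.span_mono ?_ (h.smul_mem_span hz 0)
    rintro _ rfl
    exact ⟨_, rfl⟩
  | zero => rw [zero_smul]; exact zero_mem _
  | add z z' _ _ hz hz' => rw [add_smul]; exact add_mem hz hz'

theorem isPointModule (h2 : (2 : k) ≠ 0) (h : IsPointSequence D j r e)
    (h0 : ∀ f, ∃ z : A D, f = z • e 0) (hli : LinearIndependent k e) {degN : ℕ → Submodule k N}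
    (hdeg : ∀ n, degN n = Submodule.span k {e n}) : IsPointModule D degN where
  isInternal := by
    obtain rfl : degN = fun n => Submodule.span k {e n} := funext hdeg
    refine DirectSum.isInternal_submodule_of_iSupIndep_of_iSup_eq_top
      hli.iSupIndep_span_singleton ?_
    rw [← h.span_eq_top h2 h0, Submodule.span_range_eq_iSup]
  smul_mem m n z hz f hf := by
    rw [hdeg] at hf ⊢
    rw [degA_eq D h2] at hz
    obtain ⟨c, rfl⟩ := Submodule.mem_span_singleton.1 hf
    rw [← algebraMap_smul (A D) c, smul_smul, ← Algebra.commutes, mul_smul, algebraMap_smul]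
    exact Submodule.smul_mem _ _ (h.smul_mem_span hz n)
  finrank_eq n := by
    rw [hdeg]; exact finrank_span_singleton (hli.ne_zero n)
  span_eq := by
    refine Submodule.eq_top_iff'.2 fun f => ?_
    obtain ⟨z, rfl⟩ := h0 f
    refine Submodule.smul_mem _ _ (Submodule.subset_span ?_)
    rw [hdeg]; exact Submodule.mem_span_singleton_self _

end IsPointSequence

variable (D)

theorem mem_submodule_point (j r : Fin 4) (c : Fin 4 → k) :
    (∀ v ∈ (point D j r).submodule, ∑ n, c n * v n = 0) ↔ ∑ n, c n * coord D j r n = 0 := by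
  rw [point, Projectivization.submodule_mk]
  constructor
  · exact fun h => h _ (Submodule.mem_span_singleton_self _)
  · intro h v hv
    obtain ⟨d, rfl⟩ := Submodule.mem_span_singleton.1 hv
    simp only [Pi.smul_apply, smul_eq_mul, mul_left_comm _ d, ← Finset.mul_sum, h, mul_zero]

local instance (p : ℙ k (Fin 4 → k)) : Module (A D) (pointModule D p) :=
  Submodule.Quotient.module (perpIdeal D p)

local instance (p : ℙ k (Fin 4 → k)) : SMul (A D) (pointModule D p) :=
  Submodule.Quotient.instSMul (perpIdeal D p)

local instance (p : ℙ k (Fin 4 → k)) : IsScalarTower k (A D) (pointModule D p) :=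
  Submodule.Quotient.isScalarTower (perpIdeal D p) (A D)

/-- The generator of `M_p`. -/
def pointGen (p : ℙ k (Fin 4 → k)) : pointModule D p := (perpIdeal D p).mkQ 1

theorem exists_smul_pointGen (p : ℙ k (Fin 4 → k)) (f : pointModule D p) :
    ∃ z : A D, f = z • pointGen D p := by
  obtain ⟨z, rfl⟩ := (perpIdeal D p).mkQ_surjective f
  exact ⟨z, by rw [pointGen, ← map_smul, smul_eq_mul, mul_one]⟩

/-- The form yₗ - (pₗ/p₀) y₀ vanishes at p; the coordinate p₀ is never zero. -/
theorem y_smul_pointGen (j r l : Fin 4) : y D l • pointGen D (point D j r) =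
    coord D j r l • (coord D j r 0)⁻¹ • y D 0 • pointGen D (point D j r) := by
  have h0 := coord_ne_zero D j r 0
  have h : y D l - (coord D j r l * (coord D j r 0)⁻¹) • y D 0 ∈ perpIdeal D (point D j r) := by
    refine Submodule.subset_span
      ⟨Pi.single l 1 - (coord D j r l * (coord D j r 0)⁻¹) • Pi.single 0 1, ?_, ?_⟩
    · rw [mem_submodule_point]
      simp [sub_mul, Finset.sum_sub_distrib, Pi.single_apply]
      field_simp
      simp
    · simp [sub_smul, Finset.sum_sub_distrib, Pi.single_apply]
  rw [← Submodule.ker_mkQ (perpIdeal D _), LinearMap.mem_ker, map_sub, sub_eq_zero] at h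
  have e : ∀ z : A D, z • pointGen D (point D j r) = (perpIdeal D (point D j r)).mkQ z :=
    fun z => by rw [pointGen, ← map_smul, smul_eq_mul, mul_one]
  rw [e, h, smul_smul, ← e, smul_assoc]

/-- The homogeneous basis of `M_p`. -/
def pointSeq (j r : Fin 4) : ℕ → pointModule D (point D j r)
  | 0 => pointGen D _
  | n + 1 => (coord D j (orbit j r n) 0)⁻¹ • y D 0 • pointSeq j r n

theorem isPointSequence_pointSeq (h2 : (2 : k) ≠ 0) (j r : Fin 4) :
    IsPointSequence D j r (pointSeq D j r) := by
  intro n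
  induction n with
  | zero => exact y_smul_pointGen D j r
  | succ n ih =>
    obtain ⟨v, hv⟩ := (pointEquations D ih).exists_eq_smul_coord D h2
    intro l
    -- The vector v supplied by the relations is pinned down by the case l = 0, which is how
    -- `pointSeq` is defined.
    have : v = pointSeq D j r (n + 2) := by
      rw [pointSeq, hv 0]
      exact (inv_smul_smul₀ (coord_ne_zero _ _ _ _) _).symm
    rw [← this]
    exact hv l

theorem degPoint_eq (h2 : (2 : k) ≠ 0) (j r : Fin 4) (n : ℕ) :
    degPoint D (point D j r) n = Submodule.span k {pointSeq D j r n} := by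
  have h := isPointSequence_pointSeq D h2 j r
  have e : ∀ z : A D, (perpIdeal D (point D j r)).mkQ z = z • pointSeq D j r 0 :=
    fun z => by rw [pointSeq, pointGen, ← map_smul, smul_eq_mul, mul_one]
  rw [degPoint, degA_eq D h2]
  apply le_antisymm
  · rintro _ ⟨z, hz, rfl⟩
    have := h.smul_mem_span hz 0
    rw [← e] at this
    exact this
  · rw [Submodule.span_singleton_le_iff_mem]
    obtain ⟨z, hz, hze⟩ := h.exists_smul_eq n
    exact ⟨z, hz, (e z).trans hze⟩

/-! ### The modules of invariants -/

/-- The matrices `qⱼⁿ qᵣ`. -/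
def orbitMatrix (j r : Fin 4) : ℕ → M₂ k
  | 0 => q D r
  | n + 1 => q D j * orbitMatrix j r n

theorem isUnit_orbitMatrix (j r : Fin 4) (n : ℕ) : IsUnit (orbitMatrix D j r n) := by
  induction n with
  | zero => exact isUnit_q D r
  | succ n ih => exact (isUnit_q D j).mul ih

theorem q_mul_orbitMatrix (j r l : Fin 4) (n : ℕ) : q D l * orbitMatrix D j r n =
    (sg l (orbit j r n) : k) • (orbitMatrix D j r n * q D l) := by
  induction n with
  | zero => exact q_commute D l r
  | succ n ih =>
    rw [orbitMatrix, orbit, sg_mulIndex, ← mul_assoc, q_commute, Matrix.smul_mul, mul_assoc, ih,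
      Matrix.mul_smul, smul_smul, Int.cast_mul, mul_assoc]

theorem sg_orbit (j r l : Fin 4) (n : ℕ) :
    (sg l (orbit j r n) : k) = (sg l r : k) * (sg l j) ^ n := by
  induction n with
  | zero => simp [orbit]
  | succ n ih => rw [orbit, sg_mulIndex, Int.cast_mul, ih]; ring

/-- The homogeneous basis of the module of invariants of `std D j r`. -/
def invVec (j r : Fin 4) (n : ℕ) : FK2 D j := emb D j n (orbitMatrix D j r n * q D 3)

/-- The sign in the action is exactly the one for moving q_g past qⱼⁿqᵣ, and q₃ turns q_gᵀ into
q_g⁻¹. Hence in this coordinate Γ acts by plain conjugation, whose invariants are the scalars. -/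
theorem std_act_emb_mul (j r : Fin 4) (g : Γ) (n : ℕ) (M : M₂ k) :
    (std D j r).act g (emb D j n (orbitMatrix D j r n * M * q D 3)) =
      emb D j n (orbitMatrix D j r n * (q D (index g) * M * qInv D (index g)) * q D 3) := by
  rw [std_act_emb, ← sg_orbit, mul_assoc, mul_assoc _ (q D 3), q_transpose]
  simp only [← mul_assoc]
  rw [q_mul_orbitMatrix]
  simp only [Matrix.smul_mul, smul_smul, sg_cast_mul_self, one_smul]

theorem invVec_mem (j r : Fin 4) (n : ℕ) : invVec D j r n ∈ (std D j r).invariants := fun g => by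
  have := std_act_emb_mul D j r g n 1
  rwa [mul_one, mul_one, q_mul_qInv, mul_one] at this

variable {D} in
theorem eq_smul_of_mem_invariants (h2 : (2 : k) ≠ 0) {j r : Fin 4} {f : FK2 D j}
    (hf : f ∈ (std D j r).invariants) (n : ℕ) :
    ∃ c : k, emb D j n (coef D j n f) = c • invVec D j r n := by
  have hcoef : ∀ g, (std D j r).act g (emb D j n (coef D j n f)) = emb D j n (coef D j n f) := by
    intro g
    -- The action commutes with the projection to degree n, so each component of an invariant is
    -- invariant.
    have : (std D j r).act g ∘ₗ emb D j n ∘ₗ coef D j n =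
        emb D j n ∘ₗ coef D j n ∘ₗ (std D j r).act g := by
      refine FK2_hom_ext fun m M => ?_
      simp only [LinearMap.comp_apply]
      rw [std_act_emb D j r g m, coef_emb, coef_emb]
      split_ifs with h
      · subst h; rw [std_act_emb]
      · rw [map_zero, map_zero]
    have := LinearMap.congr_fun this f
    simp only [LinearMap.comp_apply] at this
    rwa [hf g] at this
  obtain ⟨N, hN⟩ := (isUnit_orbitMatrix D j r n).dvd (a := coef D j n f * qInv D 3)
  have hM : coef D j n f = orbitMatrix D j r n * N * q D 3 := by
    rw [← hN, mul_assoc, qInv_mul_q, mul_one]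
  have hq : ∀ l, N * q D l = q D l * N := fun l => by
    obtain ⟨g, rfl⟩ := index_surjective l
    have := hcoef g
    rw [hM, std_act_emb_mul] at this
    have := (isUnit_orbitMatrix D j r n).mul_right_injective
      ((isUnit_q D 3).mul_left_injective (emb_injective D j n this))
    nth_rw 1 [← this]
    rw [mul_assoc, qInv_mul_q, mul_one]
  refine ⟨N 0 0, ?_⟩
  rw [hM, eq_smul_one_of_commute D h2 N (hq 1) (hq 3), invVec, Matrix.mul_smul, mul_one,
    Matrix.smul_mul, map_smul]
  simp

theorem linearIndependent_invVec (j r : Fin 4) : LinearIndependent k (invVec D j r) := by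
  rw [linearIndependent_iff']
  intro s g hg n hn
  have := congrArg (coef D j n) hg
  rw [map_sum, Finset.sum_eq_single n, map_smul, map_zero, invVec, coef_emb_self] at this
  · exact (smul_eq_zero.1 this).resolve_right
      ((isUnit_orbitMatrix D j r n).mul (isUnit_q D 3)).ne_zero
  · intro m _ hm
    rw [map_smul, invVec, coef_emb, if_neg hm.symm, smul_zero]
  · exact fun h => absurd hn h

/-- The inverse of qₗ arising from its transpose moves past qⱼⁿqᵣ at the cost of a sign and cancels
the qₗ inside ρⱼ(xₗ), leaving κⱼₗ qⱼ. -/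
theorem y_smul_invVec (j r l : Fin 4) (n : ℕ) : (y D l : S' D) • invVec D j r n =
    coord D j (orbit j r n) l • invVec D j r (n + 1) := by
  change (x D l ⊗ₜ[k] q D l : S' D) • invVec D j r n = _
  rw [invVec, x_smul_emb, mul_assoc, mul_assoc, q_transpose, ← mul_assoc (orbitMatrix D j r n),
    mul_qInv_of_commute D (q_mul_orbitMatrix D j r l n), Matrix.smul_mul, Matrix.mul_smul,
    ← mul_assoc, ← mul_assoc, rhoX_mul_qInv, Matrix.smul_mul, Matrix.smul_mul, smul_smul, map_smul,
    mul_comm _ (kappa D j l)]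
  rfl

local instance {j : Fin 4} (σ : EquivariantStructure D j) : Module (A D) σ.invariants :=
  σ.invariants.module

local instance {j : Fin 4} (σ : EquivariantStructure D j) : MulAction (A D) σ.invariants :=
  σ.invariants.module.toMulAction

local instance {j : Fin 4} (σ : EquivariantStructure D j) : SMul (A D) σ.invariants :=
  σ.invariants.module.toSMul

/-- The homogeneous basis of the module of invariants of `std D j r`. -/
def invSeq (j r : Fin 4) (n : ℕ) : (std D j r).invariants := ⟨invVec D j r n, invVec_mem D j r n⟩

theorem isPointSequence_invSeq (j r : Fin 4) : IsPointSequence D j r (invSeq D j r) :=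
  fun n l => Subtype.ext (y_smul_invVec D j r l n)

theorem linearIndependent_invSeq (j r : Fin 4) : LinearIndependent k (invSeq D j r) :=
  LinearIndependent.of_comp ((std D j r).invariants.subtype.restrictScalars k)
    (linearIndependent_invVec D j r)

theorem degInvariants_eq (h2 : (2 : k) ≠ 0) (j r : Fin 4) (n : ℕ) :
    (std D j r).degInvariants n = Submodule.span k {invSeq D j r n} := by
  apply le_antisymm
  · intro f hf
    obtain ⟨c, hc⟩ := eq_smul_of_mem_invariants h2 f.2 n
    replace hc := (emb_coef hf).symm.trans hc
    exact Submodule.mem_span_singleton.2 ⟨c, Subtype.ext hc.symm⟩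
  · rw [Submodule.span_singleton_le_iff_mem]
    exact emb_mem D j n _

theorem span_invSeq (h2 : (2 : k) ≠ 0) (j r : Fin 4) :
    Submodule.span k (Set.range (invSeq D j r)) = ⊤ := by
  refine Submodule.eq_top_iff'.2 fun f => ?_
  obtain ⟨s, hs⟩ := exists_eq_sum_emb (f : FK2 D j)
  choose c hc using eq_smul_of_mem_invariants h2 f.2
  have : f = ∑ n ∈ s, c n • invSeq D j r n := by
    apply Subtype.ext
    rw [AddSubmonoidClass.coe_finsetSum]
    exact hs.trans (Finset.sum_congr rfl fun n _ => hc n)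
  rw [this]
  exact Submodule.sum_mem _ fun n _ =>
    Submodule.smul_mem _ _ (Submodule.subset_span (Set.mem_range_self n))

/-! ### Comparison of the point modules with the modules of invariants -/

theorem perpIdeal_le_ker (j r : Fin 4) : perpIdeal D (point D j r) ≤
    LinearMap.ker (LinearMap.toSpanSingleton (A D) _ (invSeq D j r 0)) := by
  refine Submodule.span_le.2 ?_
  rintro _ ⟨c, hc, rfl⟩
  rw [mem_submodule_point] at hc
  have h := isPointSequence_invSeq D j r 0
  rw [SetLike.mem_coe, LinearMap.mem_ker, LinearMap.toSpanSingleton_apply, Finset.sum_smul]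
  simp only [smul_assoc, h, orbit]
  simp only [smul_smul]
  rw [← Finset.sum_smul, hc, zero_smul]

/-- The homomorphism from `M_p` to the module of invariants that maps the generator to the
generator. -/
def toInvariants (j r : Fin 4) :
    pointModule D (point D j r) →ₗ[A D] (std D j r).invariants :=
  (perpIdeal D (point D j r)).liftQ (LinearMap.toSpanSingleton (A D) _ (invSeq D j r 0))
    (perpIdeal_le_ker D j r)

theorem toInvariants_pointSeq (j r : Fin 4) (n : ℕ) :
    toInvariants D j r (pointSeq D j r n) = invSeq D j r n := by
  induction n with
  | zero =>
    exact ((perpIdeal D (point D j r)).liftQ_apply _ _).trans (one_smul _ _)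
  | succ n ih =>
    rw [pointSeq, LinearMap.map_smul_of_tower, LinearMap.map_smul, ih, isPointSequence_invSeq,
      inv_smul_smul₀ (coord_ne_zero _ _ _ _)]

/-- The relations only bound M_p from above; that no component vanishes is seen from its image in
the invariants. -/
theorem linearIndependent_pointSeq (j r : Fin 4) : LinearIndependent k (pointSeq D j r) :=
  LinearIndependent.of_comp ((toInvariants D j r).restrictScalars k) (by
    have : (toInvariants D j r).restrictScalars k ∘ pointSeq D j r = invSeq D j r :=
      funext (toInvariants_pointSeq D j r)
    rw [this]
    exact linearIndependent_invSeq D j r)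

theorem span_pointSeq (h2 : (2 : k) ≠ 0) (j r : Fin 4) :
    Submodule.span k (Set.range (pointSeq D j r)) = ⊤ :=
  (isPointSequence_pointSeq D h2 j r).span_eq_top h2 (exists_smul_pointGen D _)

theorem isPointModule_degPoint (h2 : (2 : k) ≠ 0) (j r : Fin 4) :
    IsPointModule D (degPoint D (point D j r)) :=
  (isPointSequence_pointSeq D h2 j r).isPointModule h2 (exists_smul_pointGen D _)
    (linearIndependent_pointSeq D j r) (degPoint_eq D h2 j r)

theorem toInvariants_bijective (h2 : (2 : k) ≠ 0) (j r : Fin 4) :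
    Function.Bijective (toInvariants D j r) := by
  let b := Module.Basis.mk (linearIndependent_pointSeq D j r) (span_pointSeq D h2 j r).ge
  let b' := Module.Basis.mk (linearIndependent_invSeq D j r) (span_invSeq D h2 j r).ge
  have : (toInvariants D j r).restrictScalars k = (b.equiv b' (Equiv.refl ℕ)).toLinearMap := by
    refine b.ext fun n => ?_
    rw [LinearEquiv.coe_coe, Module.Basis.equiv_apply, Module.Basis.mk_apply, Module.Basis.mk_apply]
    exact toInvariants_pointSeq D j r n
  have h := (b.equiv b' (Equiv.refl ℕ)).bijective
  rw [← LinearEquiv.coe_coe, ← this] at h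
  exact h

theorem grIso_invariants (h2 : (2 : k) ≠ 0) (j r : Fin 4) :
    GrIso D (degPoint D (point D j r)) (std D j r).degInvariants := by
  refine ⟨LinearEquiv.ofBijective _ (toInvariants_bijective D h2 j r), fun n f => ?_⟩
  have hinj := (toInvariants_bijective D h2 j r).1
  rw [degPoint_eq D h2, degInvariants_eq D h2, LinearEquiv.ofBijective_apply,
    Submodule.mem_span_singleton, Submodule.mem_span_singleton, ← toInvariants_pointSeq]
  refine exists_congr fun c => ?_
  rw [← LinearMap.map_smul_of_tower, hinj.eq_iff]

variable {D} in
theorem GrIso.trans_symm {N N' N'' : Type*} [AddCommMonoid N] [Module k N] [Module (A D) N]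
    [AddCommMonoid N'] [Module k N'] [Module (A D) N'] [AddCommMonoid N''] [Module k N'']
    [Module (A D) N''] {d : ℕ → Submodule k N} {d' : ℕ → Submodule k N'}
    {d'' : ℕ → Submodule k N''} (h : GrIso D d d'') (h' : GrIso D d' d'') : GrIso D d d' := by
  obtain ⟨e, he⟩ := h
  obtain ⟨e', he'⟩ := h'
  exact ⟨e.trans e'.symm, fun n f => by simp [he, he']⟩

/-- A graded isomorphism rescales the basis vectors of degrees 0 and 1, so it changes the
coordinates of the point only by a common factor. -/
theorem eq_of_grIso (h2 : (2 : k) ≠ 0) {j r r' : Fin 4}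
    (h : GrIso D (degPoint D (point D j r)) (degPoint D (point D j r'))) : r = r' := by
  obtain ⟨e, he⟩ := h
  have key : ∀ n, ∃ c : k, e (pointSeq D j r n) = c • pointSeq D j r' n := fun n => by
    have := (he n (pointSeq D j r n)).1 (by
      rw [degPoint_eq D h2]; exact Submodule.mem_span_singleton_self _)
    rw [degPoint_eq D h2] at this
    obtain ⟨c, hc⟩ := Submodule.mem_span_singleton.1 this
    exact ⟨c, hc.symm⟩
  obtain ⟨c, hc⟩ := key 0
  obtain ⟨d, hd⟩ := key 1
  have hd0 : d ≠ 0 := by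
    rintro rfl
    rw [zero_smul, LinearEquiv.map_eq_zero_iff] at hd
    exact (linearIndependent_pointSeq D j r).ne_zero 1 hd
  refine eq_of_coord_eq_smul D h2 (j := j) (c / d) fun l => ?_
  have h1 := congrArg e (isPointSequence_pointSeq D h2 j r 0 l)
  have h1' := (isPointSequence_pointSeq D h2 j r').y_smul_smul 0 l c
  rw [map_smul, hc, LinearMapClass.map_smul_of_tower e, hd, h1', smul_smul] at h1
  have := smul_left_injective k ((linearIndependent_pointSeq D j r').ne_zero 1) h1
  simp only [orbit] at this
  field_simp
  exact this.symm

end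

end Sklyanin

end

/-! ### The correspondence between equivariant structures and points. -/

theorem proposition3p5 {k : Type*} [Field k] [IsAlgClosed k]
    (h2 : ringChar k ≠ 2) (h3 : ringChar k ≠ 3)
    (D : Sklyanin.Parameters k) (j : Fin 4) :
    -- up to isomorphism there are exactly four equivariant structures
    Nat.card (Quotient (Sklyanin.EquivariantStructure.setoid D j)) = 4 ∧
    -- the set `𝔓ⱼ` consists of four points, whose modules are pairwise non-isomorphic point modules
    (Sklyanin.ordinaryPoints D j).ncard = 4 ∧
    (∀ p ∈ Sklyanin.ordinaryPoints D j, Sklyanin.IsPointModule D (Sklyanin.degPoint D p)) ∧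
    (∀ p ∈ Sklyanin.ordinaryPoints D j, ∀ p' ∈ Sklyanin.ordinaryPoints D j,
      Sklyanin.GrIso D (Sklyanin.degPoint D p) (Sklyanin.degPoint D p') → p = p') ∧
    -- the invariants of every equivariant structure form one of these point modules
    (∀ σ : Sklyanin.EquivariantStructure D j, ∃ p ∈ Sklyanin.ordinaryPoints D j,
      Sklyanin.GrIso D (Sklyanin.degPoint D p) σ.degInvariants) ∧
    -- each of them arises from an equivariant structure, unique up to isomorphism
    (∀ p ∈ Sklyanin.ordinaryPoints D j, ∃ σ : Sklyanin.EquivariantStructure D j,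
      Sklyanin.GrIso D (Sklyanin.degPoint D p) σ.degInvariants ∧
      ∀ σ' : Sklyanin.EquivariantStructure D j,
        Sklyanin.GrIso D (Sklyanin.degPoint D p) σ'.degInvariants → σ'.Iso σ) := by
  have hk : (2 : k) ≠ 0 := Ring.two_ne_zero h2
  refine ⟨Sklyanin.card_quotient hk, Sklyanin.ncard_ordinaryPoints D hk j, ?_⟩
  rw [Sklyanin.ordinaryPoints_eq]
  refine ⟨?_, ?_, ?_, ?_⟩
  · rintro _ ⟨r, rfl⟩
    exact Sklyanin.isPointModule_degPoint D hk j r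
  · rintro _ ⟨r, rfl⟩ _ ⟨r', rfl⟩ h
    rw [Sklyanin.eq_of_grIso D hk h]
  · intro σ
    obtain ⟨r, rfl⟩ := Sklyanin.eq_std hk σ
    exact ⟨_, ⟨r, rfl⟩, Sklyanin.grIso_invariants D hk j r⟩
  · rintro _ ⟨r, rfl⟩
    refine ⟨Sklyanin.std D j r, Sklyanin.grIso_invariants D hk j r, fun σ' h => ?_⟩
    -- Uniqueness: σ' is again standard, its invariants are the module of its own point, and
    -- non-isomorphic point modules separate the indices.
    obtain ⟨r', rfl⟩ := Sklyanin.eq_std hk σ'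
    rw [Sklyanin.eq_of_grIso D hk (h.trans_symm (Sklyanin.grIso_invariants D hk j r'))]
    exact (Sklyanin.EquivariantStructure.setoid D j).refl _
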